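/- \textbf{Setting.} Let $n_1,\dots,n_m\ge 1$ and $r\le n_1$; index vectors in $\mathbb C^{n_j}$ by $0,1,\dots,n_j-1$ and let $\|\cdot\|$ be the Euclidean (Hilbert--Schmidt) norm on $\mathbb C^{n_1\times\cdots\times n_m}$. Let $P=\{(j,k):2\le j\le m,\ 1\le k\le n_j-1\}$ and let $\xi=(\xi_{j,k})_{(j,k)\in P}$ be positive weights. For a tensor $\mathcal F$ and $2\le j\le m$, let $A[\mathcal F,j]$ be the matrix with $r$ columns $\ell=0,\dots,r-1$, with rows indexed by the multi-indices $\mu=(\mu_1,\dots,\mu_m)$ such that $\mu_1=\mu_j=0$, and with $(\mu,\ell)$ entry equal to the entry of $\mathcal F$ at the multi-index obtained from $\mu$ by setting $\mu_1=\ell$. For $\tau=(i,j,k)$ with $0\le i\le r-1$ and $(j,k)\in P$, let $b[\mathcal F,\tau]$ be the vector whose $\mu$ entry is the entry of $\mathcal F$ at the multi-index obtained from $\mu$ by setting $\mu_1=i$, $\mu_j=k$. \textbf{Algorithm} (input $\mathcal F$, $r$, $\xi$). (1) Choose a minimizer $G$ (columns $G(:,\tau)\in\mathbb C^r$) of $\sum_{\tau=(i,j,k)}\|A[\mathcal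 F,j]G(:,\tau)-b[\mathcal F,\tau]\|_2^2$. (2) Let $\hat M^{j,k}$ be the $r\times r$ matrix with $(i,\ell)$ entry $G(\ell,(i,j,k))$, let $\hat M(\xi)=\sum_{(j,k)\in P}\xi_{j,k}\hat M^{j,k}$, and choose a Schur decomposition $Q^*\hat M(\xi)Q=T$ with $Q=[q_1\cdots q_r]$ unitary and $T$ upper triangular. (3) For $1\le s\le r$ and $2\le j\le m$ put $\hat v^{s,j}=(1,\,q_s^*\hat M^{j,1}q_s,\dots,q_s^*\hat M^{j,n_j-1}q_s)$, and choose a minimizer $(\hat v^{1,1},\dots,\hat v^{r,1})$ of $\|\sum_{s=1}^r z_s\otimes\hat v^{s,2}\otimes\cdots\otimes\hat v^{s,m}-\mathcal F\|^2$ over $z_1,\dots,z_r\in\mathbb C^{n_1}$. (4) Put $\mathcal X^{gp}=\sum_{s=1}^r\hat v^{s,1}\otimes\hat v^{s,2}\otimes\cdots\otimes\hat v^{s,m}$. (5) Starting from the tuples $\hat v^{(s)}$, compute tuples $\hat u^{(s)}$ that improve them (or are as good) for the problem of minimizing $\|\sum_s u^{s,1}\otimes\cdots\otimes u^{s,m}-\mathcal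 F\|^2$, i.e. whose objective value is not larger, and put $\mathcal X^{opt}=\sum_s\hat u^{s,1}\otimes\cdots\otimes\hat u^{s,m}$. \textbf{Theorem.} There is a real-valued function $C(\mathcal F,\xi)$ such that the following holds. Let $\mathcal X^{bs}=\sum_{s=1}^r u^{s,1}\otimes\cdots\otimes u^{s,m}$ with $(u^{s,j})_0=1$ for all $s$ and all $j\ge 2$, and let $\xi$ be positive weights. Assume that i) the vectors $((u^{s,1})_0,\dots,(u^{s,1})_{r-1})\in\mathbb C^r$, $s=1,\dots,r$, are linearly independent, and the tensors $u^{s,2}\otimes\cdots\otimes u^{s,m}$, $s=1,\dots,r$, are linearly independent; ii) each $A[\mathcal X^{bs},j]$, $2\le j\le m$, has full column rank $r$; iv) the $r$ scalars $\sum_{(j,k)\in P}\xi_{j,k}(u^{s,j})_k$, $s=1,\dots,r$, are pairwise distinct. Then there are $\delta>0$ and $K\in\mathbb R$ such that for every tensor $\mathcal F$ with $\varepsilon:=\|\mathcal F-\mathcal X^{bs}\|<\delta$ for which iii) $(u^{(1)},\dots,u^{(r)})$ is scaling-optimal, i.e. $(u^{1,1},\dots,u^{r,1})$ minimizes $\|\sum_{s=1}^r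 y_s\otimes u^{s,2}\otimes\cdots\otimes u^{s,m}-\mathcal F\|^2$ over $y_1,\dots,y_r\in\mathbb C^{n_1}$, one has $C(\mathcal F,\xi)\le K$, and all tensors $\mathcal X^{gp},\mathcal X^{opt}$ produced by the algorithm from $\mathcal F$, $r$ and $\xi$ satisfy $$\|\mathcal X^{bs}-\mathcal X^{gp}\|\le C(\mathcal F,\xi)\,\varepsilon,\qquad \|\mathcal F-\mathcal X^{opt}\|\le\|\mathcal F-\mathcal X^{gp}\|\le C(\mathcal F,\xi)\,\varepsilon .$$ That is, for $\varepsilon$ small, $\|\mathcal X^{bs}-\mathcal X^{gp}\|=O(\varepsilon)$ and $\|\mathcal F-\mathcal X^{opt}\|\le\|\mathcal F-\mathcal X^{gp}\|=O(\varepsilon)$ with constants that depend only on $\mathcal F$ and $\xi$ (and the format and $r$) and stay bounded as $\mathcal F\to\mathcal X^{bs}$. -/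

import Mathlib

open scoped BigOperators

noncomputable section

namespace LowRank

/-- Complex tensors of order `p` whose `j`-th mode has dimension `n j + 1` (every mode has positive
dimension), with entries indexed from `0`. The norm is the square root of the sum of the squared
moduli of all entries. -/
abbrev Tensor {p : ℕ} (n : Fin p → ℕ) : Type :=
  EuclideanSpace ℂ ((j : Fin p) → Fin (n j + 1))

/-- Tuples of vectors, one for each mode. -/
abbrev Vectors {p : ℕ} (n : Fin p → ℕ) : Type :=
  (j : Fin p) → Fin (n j + 1) → ℂ

/-- The outer product `w 0 ⊗ ⋯ ⊗ w (p - 1)`. -/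
def outer {p : ℕ} {n : Fin p → ℕ} (w : Vectors n) : Tensor n :=
  WithLp.toLp 2 fun i => ∏ j, w j (i j)

/-- The tensor `∑ s, u s 0 ⊗ ⋯ ⊗ u s (p - 1)`. -/
def sumOuter {p r : ℕ} {n : Fin p → ℕ} (u : Fin r → Vectors n) : Tensor n :=
  ∑ s, outer (u s)

/-- The tuple with first vector `z` and remaining vectors `v`. -/
def consVec {m : ℕ} {n : Fin (m + 1) → ℕ} (z : Fin (n 0 + 1) → ℂ)
    (v : Vectors fun j : Fin m => n j.succ) : Vectors n :=
  Fin.cons (α := fun j => Fin (n j + 1) → ℂ) z v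

/-- The vectors of all modes except the first one. -/
def tailVec {m : ℕ} {n : Fin (m + 1) → ℕ} (w : Vectors n) :
    Vectors fun j : Fin m => n j.succ :=
  fun j => w j.succ

/-- The squared residual of the best rank-`r` approximation problem for `F`. -/
def objective {p r : ℕ} {n : Fin p → ℕ} (F : Tensor n) (u : Fin r → Vectors n) : ℝ :=
  ‖sumOuter u - F‖ ^ 2

/-- The squared residual as a function of the first-mode vectors, the other ones being fixed. -/
def scalingObjective {m r : ℕ} {n : Fin (m + 1) → ℕ} (F : Tensor n)
    (v : Fin r → Vectors fun j : Fin m => n j.succ) (z : Fin r → Fin (n 0 + 1) → ℂ) : ℝ :=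
  objective F fun s => consVec (z s) (v s)

/-- `u` is scaling-optimal for `F`: its first-mode vectors solve the linear least squares problem
in which the vectors of all other modes are fixed. -/
def ScalingOptimal {m r : ℕ} {n : Fin (m + 1) → ℕ} (F : Tensor n) (u : Fin r → Vectors n) :
    Prop :=
  ∀ y : Fin r → Fin (n 0 + 1) → ℂ,
    scalingObjective F (fun s => tailVec (u s)) (fun s => u s 0) ≤
      scalingObjective F (fun s => tailVec (u s)) y

/-- The pairs `(j, k)` of a mode other than the first one and a nonzero index in that mode: the
pair `⟨j, k⟩` stands for the index `k.succ` in the mode `j.succ`. -/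
abbrev Pair {m : ℕ} (n : Fin (m + 1) → ℕ) : Type :=
  (j : Fin m) × Fin (n j.succ)

/-- The multilinear monomials that involve neither the variables of the first mode nor those of the
mode `j.succ`, written as multi-indices. -/
abbrev CoMonomial {m : ℕ} (n : Fin (m + 1) → ℕ) (j : Fin m) : Type :=
  {μ : (i : Fin (m + 1)) → Fin (n i + 1) // μ 0 = 0 ∧ μ j.succ = 0}

/-- The first `r` indices of the first mode. -/
abbrev firstIdx {m r : ℕ} {n : Fin (m + 1) → ℕ} (hr : r ≤ n 0 + 1) (l : Fin r) : Fin (n 0 + 1) :=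
  Fin.castLE hr l

/-- The matrix `A[F, j]`: its `(μ, l)` entry is the entry of `F` at the monomial `x_{1,l} μ`. -/
def matA {m r : ℕ} {n : Fin (m + 1) → ℕ} (hr : r ≤ n 0 + 1) (F : Tensor n) (j : Fin m) :
    Matrix (CoMonomial n j) (Fin r) ℂ :=
  Matrix.of fun μ l => F (Function.update μ.1 0 (firstIdx hr l))

/-- The vector `b[F, (i, j, k)]`: its `μ` entry is the entry of `F` at `x_{1,i} x_{j,k} μ`. -/
def vecB {m r : ℕ} {n : Fin (m + 1) → ℕ} (hr : r ≤ n 0 + 1) (F : Tensor n) (i : Fin r)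
    (q : Pair n) : CoMonomial n q.1 → ℂ :=
  fun μ => F (Function.update (Function.update μ.1 0 (firstIdx hr i)) q.1.succ q.2.succ)

/-- The sum over all `τ = (i, j, k)` of `‖A[F, j] G(:, τ) - b[F, τ]‖²`. -/
def genObjective {m r : ℕ} {n : Fin (m + 1) → ℕ} (hr : r ≤ n 0 + 1) (F : Tensor n)
    (G : Matrix (Fin r) (Fin r × Pair n) ℂ) : ℝ :=
  ∑ τ : Fin r × Pair n,
    ‖WithLp.toLp 2 (Matrix.mulVec (matA hr F τ.2.1) (fun l => G l τ) - vecB hr F τ.1 τ.2)‖ ^ 2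

/-- The matrix `M^{j,k}(G)`, with `(i, l)` entry `G(l, (i, j, k))`. -/
def matM {m r : ℕ} {n : Fin (m + 1) → ℕ} (G : Matrix (Fin r) (Fin r × Pair n) ℂ) (q : Pair n) :
    Matrix (Fin r) (Fin r) ℂ :=
  Matrix.of fun i l => G l (i, q)

/-- The weighted sum `M(ξ) = ∑ ξ_{j,k} M^{j,k}(G)`. -/
def matMxi {m r : ℕ} {n : Fin (m + 1) → ℕ} (G : Matrix (Fin r) (Fin r × Pair n) ℂ)
    (ξ : Pair n → ℝ) : Matrix (Fin r) (Fin r) ℂ :=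
  ∑ q : Pair n, (ξ q : ℂ) • matM G q

/-- The vector `(1, q_s^* M^{j,1} q_s, …, q_s^* M^{j,n_j - 1} q_s)`, with `q_s` the `s`-th column
of `Q`. -/
def hatV {m r : ℕ} {n : Fin (m + 1) → ℕ} (G : Matrix (Fin r) (Fin r × Pair n) ℂ)
    (Q : Matrix (Fin r) (Fin r) ℂ) (s : Fin r) : Vectors fun j : Fin m => n j.succ :=
  fun j => Fin.cons 1 fun k =>
    dotProduct (star fun i => Q i s) (Matrix.mulVec (matM G ⟨j, k⟩) fun i => Q i s)

/-- A run of the generating polynomial algorithm with input `F` and weights `ξ`. Every choice that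
the algorithm leaves open (minimizers that need not be unique, the Schur decomposition, the method
used for the final improvement) is free. -/
structure Run {m r : ℕ} {n : Fin (m + 1) → ℕ} (hr : r ≤ n 0 + 1) (F : Tensor n)
    (ξ : Pair n → ℝ) where
  /-- Step 1: an optimizer of the linear least squares problem for the generating matrix. -/
  G : Matrix (Fin r) (Fin r × Pair n) ℂ
  G_opt : ∀ G' : Matrix (Fin r) (Fin r × Pair n) ℂ, genObjective hr F G ≤ genObjective hr F G'
  /-- Step 2: a Schur decomposition of `M(ξ)`. -/
  Q : Matrix (Fin r) (Fin r) ℂ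
  T : Matrix (Fin r) (Fin r) ℂ
  Q_unitary : Q ∈ Matrix.unitaryGroup (Fin r) ℂ
  T_upper : ∀ a b : Fin r, b < a → T a b = 0
  schur : Q.conjTranspose * matMxi G ξ * Q = T
  /-- Step 3: an optimizer of the linear least squares problem for the first-mode vectors. -/
  z : Fin r → Fin (n 0 + 1) → ℂ
  z_opt : ∀ y : Fin r → Fin (n 0 + 1) → ℂ,
    scalingObjective F (hatV G Q) z ≤ scalingObjective F (hatV G Q) y
  /-- Step 5: a tuple that improves the tuple of Step 3 (or is as good as it) for the best
  rank-`r` approximation problem. -/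
  w : Fin r → Vectors n
  w_improved : objective F w ≤ objective F fun s => consVec (z s) (hatV G Q s)

/-- Step 4: the tensor `X^gp`. -/
def Run.Xgp {m r : ℕ} {n : Fin (m + 1) → ℕ} {hr : r ≤ n 0 + 1} {F : Tensor n} {ξ : Pair n → ℝ}
    (R : Run hr F ξ) : Tensor n :=
  sumOuter fun s => consVec (R.z s) (hatV R.G R.Q s)

/-- Step 5: the output tensor `X^opt`. -/
def Run.Xopt {m r : ℕ} {n : Fin (m + 1) → ℕ} {hr : r ≤ n 0 + 1} {F : Tensor n} {ξ : Pair n → ℝ}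
    (R : Run hr F ξ) : Tensor n :=
  sumOuter R.w

end LowRank

end

/-! If X is the tensor of normalized tuples u and V has the truncated first-mode vectors as columns,
then the systems A[X, j] G(:, τ) = b[X, τ] are solved exactly by the G with M^{j,k} = V
diag(u^{s,j}_k) V⁻¹. Full column rank makes least squares minimizers for F differ from this G by
O(ε) (`exists_generating_stability`).

The exact M(ξ) has simple spectrum, so each exact M^{j,k} is an interpolation polynomial p in it. If
B is the computed M(ξ) and Qᴴ B Q = T is triangular, the diagonal of Qᴴ p(B) Q is p(T_ss). Bounds on
p and on the eigenvalue shift therefore recover all u^{s,j}_k up to O(ε) and a permutation of s,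
with no need for V or Q to depend continuously on the data (`exists_schur_perturbation`). The
permuted true first-mode vectors then compete in the last least squares problem, so its residual is
O(ε).

The constant may depend on F and ξ but not on u. Hence every estimate is uniform over all
nondegenerate tuples whose tensor is close to a given one; the tuples themselves are never assumed
close, and the first-mode vectors are bounded through the tensor and the spectral projections
(`exists_first_mode_bound`). An infimum over natural numbers then selects one constant for each F
(`errorConstant`). -/

noncomputable section

namespace LowRank

/-! ### Uniform Lipschitz estimates and stability of full column rank -/

open Polynomial in
/-- Products of linear polynomials with bounded coefficients are uniformly bounded and uniformly
Lipschitz on bounded subsets of a normed algebra. -/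
theorem exists_lipschitz_aeval_prod (𝔸 : Type*) [NormedRing 𝔸] [NormedAlgebra ℂ 𝔸] {ι : Type*}
    (S : Finset ι) (R : ℝ) :
    ∃ K : ℝ, 0 ≤ K ∧ ∀ α β : ι → ℂ, (∀ t, ‖α t‖ ≤ R) → (∀ t, ‖β t‖ ≤ R) →
      ∀ x y : 𝔸, ‖x‖ ≤ R → ‖y‖ ≤ R →
        ‖aeval x (∏ t ∈ S, C (α t) * (X - C (β t)))‖ ≤ K ∧
        ‖aeval x (∏ t ∈ S, C (α t) * (X - C (β t))) -
          aeval y (∏ t ∈ S, C (α t) * (X - C (β t)))‖ ≤ K * ‖x - y‖ := by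
  classical
  induction S using Finset.induction_on with
  | empty =>
    refine ⟨‖(1 : 𝔸)‖, norm_nonneg _, fun α β hα hβ x y hx hy => ?_⟩
    simp only [Finset.prod_empty, map_one, le_refl, sub_self, norm_zero, true_and]
    positivity
  | insert a S ha ih =>
    obtain ⟨K, hK, h⟩ := ih
    by_cases hR : 0 ≤ R
    swap
    · refine ⟨0, le_rfl, fun α β hα hβ x y hx hy => absurd ((norm_nonneg x).trans hx) hR⟩
    -- The first summand is a bound for the new linear factor times `K`; the second accounts for
    -- varying that factor against a product bounded by `K`.
    refine ⟨R * (R + R * ‖(1 : 𝔸)‖) * K + R * K, by positivity, fun α β hα hβ x y hx hy => ?_⟩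
    obtain ⟨h1, h2⟩ := h α β hα hβ x y hx hy
    obtain ⟨h3, -⟩ := h α β hα hβ y x hy hx
    simp only [Finset.prod_insert ha, map_mul, aeval_C, map_sub, aeval_X] at h1 h2 h3 ⊢
    set p := aeval x (∏ t ∈ S, C (α t) * (X - C (β t))) with hp
    set q := aeval y (∏ t ∈ S, C (α t) * (X - C (β t))) with hq
    simp only [Algebra.algebraMap_eq_smul_one, smul_one_mul] at *
    have hlin : ∀ z : 𝔸, ‖z‖ ≤ R → ‖α a • (z - β a • (1 : 𝔸))‖ ≤ R * (R + R * ‖(1 : 𝔸)‖) := by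
      intro z hz
      rw [norm_smul]
      have h4 : ‖z - β a • (1 : 𝔸)‖ ≤ R + R * ‖(1 : 𝔸)‖ := by
        refine (norm_sub_le _ _).trans (add_le_add hz ?_)
        rw [norm_smul]
        exact mul_le_mul_of_nonneg_right (hβ a) (norm_nonneg _)
      exact mul_le_mul (hα a) h4 (norm_nonneg _) hR
    constructor
    · refine (norm_mul_le _ _).trans ((mul_le_mul (hlin x hx) h1 (norm_nonneg _)
        (by positivity)).trans ?_)
      have : 0 ≤ R * K := by positivity
      linarith
    · have e : (α a • (x - β a • (1 : 𝔸))) * p - (α a • (y - β a • (1 : 𝔸))) * q =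
          (α a • (x - β a • (1 : 𝔸))) * (p - q) + (α a • (x - y)) * q := by
        simp only [smul_sub, mul_sub, sub_mul]
        abel
      rw [e, add_mul]
      refine (norm_add_le _ _).trans (add_le_add ?_ ?_)
      · refine (norm_mul_le _ _).trans ((mul_le_mul (hlin x hx) h2 (norm_nonneg _)
          (by positivity)).trans_eq (by ring))
      · refine (norm_mul_le _ _).trans ?_
        rw [norm_smul]
        calc ‖α a‖ * ‖x - y‖ * ‖q‖ ≤ R * ‖x - y‖ * K := by
              gcongr
              exact hα a
          _ = R * K * ‖x - y‖ := by ring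

open Polynomial in
/-- Interpolation polynomials with bounded data and separated nodes are uniformly bounded and
uniformly Lipschitz on bounded subsets of a normed algebra. -/
theorem exists_lipschitz_aeval_interpolate (𝔸 : Type*) [NormedRing 𝔸] [NormedAlgebra ℂ 𝔸]
    {ι : Type*} [Fintype ι] [DecidableEq ι] (R γ : ℝ) (hγ : 0 < γ) :
    ∃ K : ℝ, 0 ≤ K ∧ ∀ β a : ι → ℂ, (∀ t, ‖β t‖ ≤ R) → (∀ t, ‖a t‖ ≤ R) →
      (∀ s t, s ≠ t → γ ≤ ‖β s - β t‖) →
      ∀ x y : 𝔸, ‖x‖ ≤ R → ‖y‖ ≤ R →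
        ‖aeval x (Lagrange.interpolate Finset.univ β a)‖ ≤ K ∧
        ‖aeval x (Lagrange.interpolate Finset.univ β a) -
          aeval y (Lagrange.interpolate Finset.univ β a)‖ ≤ K * ‖x - y‖ := by
  by_cases hR : 0 ≤ R
  swap
  · exact ⟨0, le_rfl, fun β a _ _ _ x y hx hy => absurd ((norm_nonneg x).trans hx) hR⟩
  choose K hK h using fun i : ι =>
    exists_lipschitz_aeval_prod 𝔸 (Finset.univ.erase i) (max R γ⁻¹)
  refine ⟨∑ i, R * K i, Finset.sum_nonneg fun i _ => mul_nonneg hR (hK i),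
    fun β a hβ ha hsep x y hx hy => ?_⟩
  have key : ∀ i : ι, ∀ x y : 𝔸, ‖x‖ ≤ R → ‖y‖ ≤ R →
      ‖aeval x (Lagrange.basis Finset.univ β i)‖ ≤ K i ∧
      ‖aeval x (Lagrange.basis Finset.univ β i) - aeval y (Lagrange.basis Finset.univ β i)‖ ≤
        K i * ‖x - y‖ := by
    intro i x y hx hy
    -- The value at `t = i` does not enter the product; `0` keeps the required bound valid at every
    -- index.
    have h0 := h i (fun t => if t = i then 0 else (β i - β t)⁻¹) β (fun t => by
      by_cases hti : t = i
      · simp only [hti, if_true, norm_zero]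
        exact hR.trans (le_max_left _ _)
      · simp only [hti, if_false, norm_inv]
        exact (inv_anti₀ hγ (hsep i t (Ne.symm hti))).trans (le_max_right _ _))
      (fun t => (hβ t).trans (le_max_left _ _)) x y (hx.trans (le_max_left _ _))
      (hy.trans (le_max_left _ _))
    have e : ∏ t ∈ Finset.univ.erase i, C (if t = i then 0 else (β i - β t)⁻¹) * (X - C (β t)) =
        Lagrange.basis Finset.univ β i := by
      refine Finset.prod_congr rfl fun t ht => ?_
      rw [if_neg (Finset.ne_of_mem_erase ht)]
      rfl
    rw [e] at h0
    exact h0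
  simp only [Lagrange.interpolate_apply, map_sum, map_mul, aeval_C, ← Algebra.smul_def,
    ← Finset.sum_sub_distrib, ← smul_sub, Finset.sum_mul]
  constructor
  · refine norm_sum_le_of_le _ fun i _ => ?_
    rw [norm_smul]
    exact mul_le_mul (ha i) (key i x y hx hy).1 (norm_nonneg _) hR
  · refine norm_sum_le_of_le _ fun i _ => ?_
    rw [norm_smul, mul_assoc]
    exact mul_le_mul (ha i) (key i x y hx hy).2 (norm_nonneg _) hR

/-- A product of bounded numbers is a Lipschitz function of its factors. -/
theorem norm_prod_sub_prod_le {ι : Type*} (S : Finset ι) {R η : ℝ} (hR : 1 ≤ R) (a b : ι → ℂ)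
    (ha : ∀ j, ‖a j‖ ≤ R) (hb : ∀ j, ‖b j‖ ≤ R) (hab : ∀ j, ‖a j - b j‖ ≤ η) :
    ‖∏ j ∈ S, a j - ∏ j ∈ S, b j‖ ≤ S.card * R ^ S.card * η := by
  classical
  have hR0 : 0 ≤ R := zero_le_one.trans hR
  induction S using Finset.induction_on with
  | empty => simp
  | insert i S hi ih =>
    have hη : 0 ≤ η := (norm_nonneg _).trans (hab i)
    rw [Finset.prod_insert hi, Finset.prod_insert hi, Finset.card_insert_of_notMem hi]
    have e : a i * ∏ j ∈ S, a j - b i * ∏ j ∈ S, b j =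
        a i * (∏ j ∈ S, a j - ∏ j ∈ S, b j) + (a i - b i) * ∏ j ∈ S, b j := by ring
    have hp : ‖∏ j ∈ S, b j‖ ≤ R ^ S.card := by
      rw [norm_prod]
      exact (Finset.prod_le_prod (fun j _ => norm_nonneg _) fun j _ => hb j).trans_eq (by simp)
    calc _ ≤ ‖a i‖ * ‖∏ j ∈ S, a j - ∏ j ∈ S, b j‖ + ‖a i - b i‖ * ‖∏ j ∈ S, b j‖ := by
          rw [e, ← norm_mul, ← norm_mul]
          exact norm_add_le _ _
      _ ≤ R * (S.card * R ^ S.card * η) + η * R ^ S.card :=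
          add_le_add (mul_le_mul (ha i) ih (norm_nonneg _) hR0)
            (mul_le_mul (hab i) hp (norm_nonneg _) hη)
      _ ≤ R * (S.card * R ^ S.card * η) + η * (R ^ S.card * R) := by
          gcongr
          exact le_mul_of_one_le_right (by positivity) hR
      _ = ((S.card + 1 : ℕ) : ℝ) * R ^ (S.card + 1) * η := by push_cast; ring

/-- Full column rank is stable under small perturbations, with a uniform lower bound. -/
theorem exists_lower_bound_mulVec {ι : Type*} [Fintype ι] {r : ℕ} (A₀ : Matrix ι (Fin r) ℂ)
    (hA : ∀ x, A₀.mulVec x = 0 → x = 0) :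
    ∃ c > 0, ∃ η > 0, ∀ A : Matrix ι (Fin r) ℂ, (∀ i l, ‖A i l - A₀ i l‖ ≤ η) →
      ∀ x, c * ‖x‖ ≤ ‖A.mulVec x‖ := by
  have hker : LinearMap.ker (Matrix.mulVecLin A₀) = ⊥ :=
    LinearMap.ker_eq_bot'.2 fun x hx => hA x (by simpa using hx)
  obtain ⟨K, hK, hanti⟩ := LinearMap.exists_antilipschitzWith _ hker
  have hK' : (0 : ℝ) < K := by exact_mod_cast hK
  -- `A₀` expands by at least `1 / K`, and the entrywise tolerance lets the perturbation use up at
  -- most half of that. The factor `r + 1` avoids division by zero when `r = 0`.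
  refine ⟨(2 * K : ℝ)⁻¹, by positivity, (2 * K * (r + 1) : ℝ)⁻¹, by positivity, fun A hAA x => ?_⟩
  have h1 : ‖x‖ ≤ K * ‖A₀.mulVec x‖ := by
    simpa using hanti.le_mul_dist x 0
  have h2 : ‖A.mulVec x - A₀.mulVec x‖ ≤ (2 * K : ℝ)⁻¹ * ‖x‖ := by
    rw [← Matrix.sub_mulVec]
    refine (pi_norm_le_iff_of_nonneg (by positivity)).2 fun i => ?_
    calc ‖((A - A₀).mulVec x) i‖ ≤ ∑ l : Fin r, ‖(A - A₀) i l * x l‖ := by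
          rw [Matrix.mulVec, dotProduct]
          exact norm_sum_le _ _
      _ ≤ ∑ _l : Fin r, (2 * K * (r + 1) : ℝ)⁻¹ * ‖x‖ := by
          refine Finset.sum_le_sum fun l _ => ?_
          rw [norm_mul]
          exact mul_le_mul (hAA i l) (norm_le_pi_norm x l) (norm_nonneg _) (by positivity)
      _ = r * ((2 * K * (r + 1) : ℝ)⁻¹ * ‖x‖) := by simp
      _ ≤ (r + 1) * ((2 * K * (r + 1) : ℝ)⁻¹ * ‖x‖) := by
          gcongr
          linarith
      _ = (2 * K : ℝ)⁻¹ * ‖x‖ := by field_simp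
  have h3 : ‖A₀.mulVec x‖ ≤ ‖A.mulVec x‖ + (2 * K : ℝ)⁻¹ * ‖x‖ := by
    have := norm_sub_norm_le (A₀.mulVec x) (A.mulVec x)
    rw [norm_sub_rev] at this
    linarith
  have h4 : (K : ℝ)⁻¹ * ‖x‖ ≤ ‖A₀.mulVec x‖ := by
    rw [inv_mul_le_iff₀ hK']
    exact h1
  have h5 : (K : ℝ)⁻¹ * ‖x‖ = (2 * K : ℝ)⁻¹ * ‖x‖ + (2 * K : ℝ)⁻¹ * ‖x‖ := by
    field_simp
    ring
  linarith

/-! ### Polynomials and characteristic determinants of conjugated and triangular matrices -/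

section Conj

open Matrix Polynomial

variable {r : ℕ}

theorem aeval_conj (P P' B : Matrix (Fin r) (Fin r) ℂ) (h : P' * P = 1) (p : ℂ[X]) :
    aeval (P' * B * P) p = P' * aeval B p * P := by
  have h' : P * P' = 1 := mul_eq_one_comm.1 h
  have hpow : ∀ k : ℕ, (P' * B * P) ^ k = P' * B ^ k * P := by
    intro k
    induction k with
    | zero => simp [h]
    | succ k ih =>
      rw [pow_succ, ih, pow_succ]
      calc P' * B ^ k * P * (P' * B * P) = P' * B ^ k * (P * P') * B * P := by
            simp only [Matrix.mul_assoc]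
        _ = _ := by rw [h', Matrix.mul_one]; simp only [Matrix.mul_assoc]
  simp only [aeval_eq_sum_range, hpow, Matrix.mul_sum, Matrix.sum_mul, Matrix.mul_smul,
    Matrix.smul_mul]

theorem aeval_diagonal (d : Fin r → ℂ) (p : ℂ[X]) :
    aeval (diagonal d) p = diagonal fun s => p.eval (d s) := by
  have h := Polynomial.aeval_algHom_apply (Matrix.diagonalAlgHom (n := Fin r) (α := ℂ) ℂ) d p
  have h2 : aeval d p = fun s => p.eval (d s) := by
    funext s
    have := Polynomial.aeval_algHom_apply (Pi.evalAlgHom ℂ (fun _ : Fin r => ℂ) s) d p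
    simp only [Pi.evalAlgHom_apply] at this
    rw [← this]
    simp
  rw [h2] at h
  simpa using h

/-- The diagonal of a polynomial in an upper triangular matrix. -/
theorem aeval_upper (T : Matrix (Fin r) (Fin r) ℂ) (hT : ∀ a b : Fin r, b < a → T a b = 0)
    (p : ℂ[X]) :
    (∀ a b : Fin r, b < a → aeval T p a b = 0) ∧ ∀ s, aeval T p s s = p.eval (T s s) := by
  have hpow : ∀ k : ℕ, (∀ a b : Fin r, b < a → (T ^ k) a b = 0) ∧
      ∀ s, (T ^ k) s s = T s s ^ k := by
    intro k
    induction k with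
    | zero =>
      refine ⟨fun a b hab => ?_, fun s => by simp⟩
      rw [pow_zero, Matrix.one_apply_ne hab.ne']
    | succ k ih =>
      obtain ⟨h1, h2⟩ := ih
      refine ⟨fun a b hab => ?_, fun s => ?_⟩
      · rw [pow_succ, Matrix.mul_apply]
        refine Finset.sum_eq_zero fun c _ => ?_
        rcases lt_or_ge c a with hc | hc
        · rw [h1 a c hc, zero_mul]
        · rw [hT c b (hab.trans_le hc), mul_zero]
      · rw [pow_succ, Matrix.mul_apply, Finset.sum_eq_single s, h2, pow_succ]
        · intro c _ hc
          rcases lt_or_gt_of_ne hc with hc | hc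
          · rw [h1 s c hc, zero_mul]
          · rw [hT c s hc, mul_zero]
        · simp
  constructor
  · intro a b hab
    rw [aeval_eq_sum_range, Matrix.sum_apply]
    exact Finset.sum_eq_zero fun k _ => by rw [Matrix.smul_apply, (hpow k).1 a b hab, smul_zero]
  · intro s
    rw [aeval_eq_sum_range, Matrix.sum_apply, eval_eq_sum_range]
    exact Finset.sum_congr rfl fun k _ => by rw [Matrix.smul_apply, (hpow k).2 s, smul_eq_mul]

theorem det_sub_conj (P P' B : Matrix (Fin r) (Fin r) ℂ) (h : P' * P = 1) (x : ℂ) :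
    (x • 1 - P' * B * P).det = (x • 1 - B).det := by
  have e : x • 1 - P' * B * P = P' * (x • 1 - B) * P := by
    rw [Matrix.mul_sub, Matrix.sub_mul, Matrix.mul_smul, Matrix.mul_one, Matrix.smul_mul, h]
  rw [e, Matrix.det_mul, Matrix.det_mul, mul_right_comm, ← Matrix.det_mul, h, Matrix.det_one,
    one_mul]

theorem det_sub_upper (T : Matrix (Fin r) (Fin r) ℂ) (hT : ∀ a b : Fin r, b < a → T a b = 0)
    (x : ℂ) : (x • 1 - T).det = ∏ s, (x - T s s) := by
  rw [Matrix.det_of_isUpperTriangular]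
  · simp
  · intro a b hab
    have : b < a := hab
    simp [hT a b this, Matrix.one_apply_ne this.ne']

end Conj

/-! ### Matching of eigenvalues and entrywise bounds -/

theorem exists_pos_forall_le {ι : Type*} [Finite ι] (f : ι → ℝ) (hf : ∀ i, 0 < f i) :
    ∃ c > 0, ∀ i, c ≤ f i := by
  rcases isEmpty_or_nonempty ι with he | hne
  · exact ⟨1, one_pos, fun i => (he.false i).elim⟩
  · obtain ⟨i, hi⟩ := Finite.exists_min f
    exact ⟨f i, hf i, hi⟩

theorem exists_separation {r : ℕ} (d : Fin r → ℂ) (hd : Function.Injective d) :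
    ∃ γ > 0, ∀ s t, s ≠ t → γ ≤ ‖d s - d t‖ := by
  have h : ∀ q : Fin r × Fin r, ∃ γ : ℝ, 0 < γ ∧ (q.1 ≠ q.2 → γ ≤ ‖d q.1 - d q.2‖) := by
    intro q
    by_cases hq : q.1 = q.2
    · exact ⟨1, one_pos, fun h => absurd hq h⟩
    · exact ⟨‖d q.1 - d q.2‖, norm_pos_iff.2 (sub_ne_zero.2 fun h => hq (hd h)), fun _ => le_rfl⟩
  choose γ hγ h using h
  obtain ⟨γ', hγ', hle⟩ := exists_pos_forall_le γ hγ
  exact ⟨γ', hγ', fun s t hst => (hle (s, t)).trans (h (s, t) hst)⟩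

/-- The eigenvalues of a matrix near a matrix with simple spectrum `lam₀` can be paired with
`lam₀`. -/
theorem exists_perm_eigenvalues_near {r : ℕ} (B₀ : Matrix (Fin r) (Fin r) ℂ) (lam₀ : Fin r → ℂ)
    (hdet : ∀ x : ℂ, (x • 1 - B₀).det = ∏ s, (x - lam₀ s)) {g : ℝ} (hg : 0 < g)
    (hsep : ∀ s t, s ≠ t → 2 * g ≤ ‖lam₀ s - lam₀ t‖) :
    ∃ η > 0, ∀ B : Matrix (Fin r) (Fin r) ℂ, (∀ i l, ‖B i l - B₀ i l‖ ≤ η) →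
      ∀ d : Fin r → ℂ, (∀ x : ℂ, (x • 1 - B).det = ∏ s, (x - d s)) →
        ∃ τ : Equiv.Perm (Fin r), ∀ s, ‖lam₀ s - d (τ s)‖ < g := by
  -- The determinant is continuous and vanishes at `B₀`. Below the threshold `g ^ r`, a product of
  -- `r` distances must contain a factor less than `g`.
  have hev : ∀ᶠ B : Fin r → Fin r → ℂ in nhds B₀, ∀ s,
      ‖(lam₀ s • 1 - (Matrix.of B)).det‖ < g ^ r := by
    refine Filter.eventually_all.2 fun s => ?_
    have hc : Continuous fun B : Fin r → Fin r → ℂ =>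
        ‖(lam₀ s • (1 : Matrix (Fin r) (Fin r) ℂ) - (Matrix.of B)).det‖ :=
      (Continuous.matrix_det (continuous_const.sub continuous_id)).norm
    refine hc.continuousAt.eventually_lt_const ?_
    change ‖(lam₀ s • 1 - B₀).det‖ < g ^ r
    rw [hdet, Finset.prod_eq_zero (Finset.mem_univ s) (sub_self _), norm_zero]
    positivity
  obtain ⟨η, hη, hball⟩ := Metric.eventually_nhds_iff.1 hev
  refine ⟨η / 2, by positivity, fun B hB d hd => ?_⟩
  have hB' : dist (show Fin r → Fin r → ℂ from B) B₀ < η := by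
    refine lt_of_le_of_lt ?_ (half_lt_self hη)
    refine (dist_pi_le_iff (by positivity)).2 fun i => (dist_pi_le_iff (by positivity)).2 fun l => ?_
    rw [dist_eq_norm]
    exact hB i l
  have hex : ∀ s, ∃ t, ‖lam₀ s - d t‖ < g := by
    intro s
    by_contra! hcon
    have h1 := hball hB' s
    change ‖(lam₀ s • 1 - B).det‖ < g ^ r at h1
    rw [hd, norm_prod] at h1
    have h2 : g ^ r ≤ ∏ t, ‖lam₀ s - d t‖ := by
      have := Finset.prod_le_prod (s := Finset.univ) (f := fun _ : Fin r => g)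
        (g := fun t => ‖lam₀ s - d t‖) (fun _ _ => hg.le) fun t _ => hcon t
      simpa using this
    linarith
  choose τ hτ using hex
  -- Two points of `lam₀` assigned to the same eigenvalue would be less than `2 * g` apart.
  have hinj : Function.Injective τ := by
    intro s t hst
    by_contra hne
    have h1 := hsep s t hne
    have h2 := hτ s
    have h3 := hτ t
    rw [← hst] at h3
    have h4 := norm_sub_le (lam₀ s - d (τ s)) (lam₀ t - d (τ s))
    rw [sub_sub_sub_cancel_right] at h4
    linarith
  exact ⟨Equiv.ofBijective τ (Finite.injective_iff_bijective.1 hinj), hτ⟩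

/-- Column `t` of `V` is a nonzero eigenvector for `a t`, so sup norms can be compared. The bound
does not involve the conditioning of `V`. -/
theorem norm_eigenvalue_le {r : ℕ} (V V' : Matrix (Fin r) (Fin r) ℂ) (hV : V' * V = 1)
    (a : Fin r → ℂ) {R : ℝ} (hR : ∀ i l, ‖(V * Matrix.diagonal a * V') i l‖ ≤ R) (t : Fin r) :
    ‖a t‖ ≤ r * R := by
  set W := V * Matrix.diagonal a * V' with hW
  have hWV : W * V = V * Matrix.diagonal a := by
    rw [hW, Matrix.mul_assoc, hV, Matrix.mul_one]
  have hv : (fun i => V i t) ≠ 0 := by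
    intro h
    have h1 : (V' * V) t t = 0 := by
      rw [Matrix.mul_apply]
      exact Finset.sum_eq_zero fun i _ => by rw [show V i t = 0 from congrFun h i, mul_zero]
    rw [hV, Matrix.one_apply_eq] at h1
    exact one_ne_zero h1
  have hpos : 0 < ‖fun i => V i t‖ := norm_pos_iff.2 hv
  refine le_of_mul_le_mul_right ?_ hpos
  rw [← norm_smul]
  have hR0 : 0 ≤ R := (norm_nonneg _).trans (hR t t)
  refine (pi_norm_le_iff_of_nonneg (by positivity)).2 fun i => ?_
  have e : (a t • fun i => V i t) i = ∑ l, W i l * V l t := by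
    rw [← Matrix.mul_apply, hWV, Matrix.mul_diagonal, Pi.smul_apply, smul_eq_mul, mul_comm]
  rw [e]
  refine (norm_sum_le_of_le (f := fun l => W i l * V l t) Finset.univ
    (n := fun _ => R * ‖fun i => V i t‖) fun l _ => ?_).trans_eq (by simp [mul_assoc])
  rw [norm_mul]
  exact mul_le_mul (hR i l) (norm_le_pi_norm (fun i => V i t) l) (norm_nonneg _) hR0

/-- Entries of a unitary matrix have modulus at most one, so the bound is independent of which Schur
basis is chosen. -/
theorem norm_unitary_conj_entry_le {r : ℕ} (Q M : Matrix (Fin r) (Fin r) ℂ)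
    (hQ : Q ∈ Matrix.unitaryGroup (Fin r) ℂ) {R : ℝ} (hR : ∀ i l, ‖M i l‖ ≤ R) (s t : Fin r) :
    ‖(Q.conjTranspose * M * Q) s t‖ ≤ r * (r * R) := by
  simp only [Matrix.mul_apply, Finset.sum_mul]
  refine (norm_sum_le_of_le _ fun i _ => norm_sum_le_of_le _ (n := fun _ => R)
    fun l _ => ?_).trans_eq (by simp)
  have h1 := entry_norm_bound_of_unitary hQ l s
  have h2 := entry_norm_bound_of_unitary hQ i t
  rw [norm_mul, norm_mul, Matrix.conjTranspose_apply, norm_star]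
  have h3 := hR l i
  calc ‖Q l s‖ * ‖M l i‖ * ‖Q i t‖ ≤ 1 * R * 1 := by
        have : 0 ≤ R := (norm_nonneg _).trans h3
        gcongr
    _ = R := by ring

theorem dotProduct_star_mulVec {r : ℕ} (Q M : Matrix (Fin r) (Fin r) ℂ) (s : Fin r) :
    dotProduct (star fun i => Q i s) (Matrix.mulVec M fun i => Q i s) =
      (Q.conjTranspose * M * Q) s s := by
  rw [Matrix.mul_assoc, Matrix.mul_apply]
  rfl

/-! ### Perturbation of Schur decompositions -/

section Spectral

attribute [local instance] Matrix.linftyOpNormedRing Matrix.linftyOpNormedAlgebra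

theorem linfty_norm_le_of_entries {r : ℕ} (A : Matrix (Fin r) (Fin r) ℂ) {R : ℝ} (hR : 0 ≤ R)
    (h : ∀ i l, ‖A i l‖ ≤ R) : ‖A‖ ≤ r * R := by
  rw [Matrix.linfty_opNorm_def]
  have : (Finset.univ.sup fun i : Fin r => ∑ j : Fin r, ‖A i j‖₊) ≤ r * R.toNNReal := by
    refine Finset.sup_le fun i _ => ?_
    refine (Finset.sum_le_sum fun j _ => (?_ : ‖A i j‖₊ ≤ R.toNNReal)).trans_eq (by simp)
    rw [← NNReal.coe_le_coe, Real.coe_toNNReal _ hR]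
    exact h i j
  have h2 := NNReal.coe_le_coe.2 this
  rwa [NNReal.coe_mul, Real.coe_toNNReal _ hR] at h2

theorem norm_entry_le_linfty_norm {r : ℕ} (A : Matrix (Fin r) (Fin r) ℂ) (i l : Fin r) :
    ‖A i l‖ ≤ ‖A‖ := by
  rw [Matrix.linfty_opNorm_def]
  have h1 : ‖A i l‖₊ ≤ ∑ j : Fin r, ‖A i j‖₊ :=
    Finset.single_le_sum (f := fun j => ‖A i j‖₊) (fun _ _ => zero_le) (Finset.mem_univ l)
  have h2 := h1.trans (Finset.le_sup (f := fun i : Fin r => ∑ j : Fin r, ‖A i j‖₊)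
    (Finset.mem_univ i))
  exact NNReal.coe_le_coe.2 h2

open Polynomial in
/-- Perturbation of simultaneously diagonalizable matrices: the diagonal of `Qᴴ * M * Q`, with `Q`
from a Schur decomposition of a perturbation of a matrix with simple spectrum, is close to the
eigenvalues. -/
theorem exists_schur_perturbation {r : ℕ} (B₀ : Matrix (Fin r) (Fin r) ℂ) (lam₀ : Fin r → ℂ)
    (hinj : Function.Injective lam₀)
    (hdet : ∀ x : ℂ, (x • 1 - B₀).det = ∏ s, (x - lam₀ s)) (R : ℝ) :
    ∃ η > 0, ∃ K : ℝ, 0 ≤ K ∧ ∀ (V V' : Matrix (Fin r) (Fin r) ℂ) (lam : Fin r → ℂ),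
      V' * V = 1 →
      (∀ i l, ‖(V * Matrix.diagonal lam * V') i l - B₀ i l‖ ≤ η) →
      (∀ s i l : Fin r,
        ‖(V * Matrix.diagonal (Pi.single s 1 : Fin r → ℂ) * V') i l‖ ≤ K) ∧
      ∀ B Q : Matrix (Fin r) (Fin r) ℂ, (∀ i l, ‖B i l - B₀ i l‖ ≤ η) →
        Q ∈ Matrix.unitaryGroup (Fin r) ℂ →
        (∀ a b : Fin r, b < a → (Q.conjTranspose * B * Q) a b = 0) →
        ∀ ε : ℝ, (∀ i l, ‖B i l - (V * Matrix.diagonal lam * V') i l‖ ≤ ε) →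
          ∃ σ : Equiv.Perm (Fin r), ∀ (a : Fin r → ℂ) (M : Matrix (Fin r) (Fin r) ℂ),
            (∀ i l, ‖(V * Matrix.diagonal a * V') i l‖ ≤ R) →
            (∀ i l, ‖M i l - (V * Matrix.diagonal a * V') i l‖ ≤ ε) →
            ∀ s, ‖(Q.conjTranspose * M * Q) s s - a (σ s)‖ ≤ K * ε := by
  obtain ⟨γ, hγ, hsep⟩ := exists_separation lam₀ hinj
  -- Matching within `γ / 4` leaves perturbed eigenvalues separated by `γ / 2`.
  obtain ⟨η, hη, hmatch⟩ := exists_perm_eigenvalues_near B₀ lam₀ hdet (g := γ / 4) (by positivity)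
    (fun s t hst => by linarith [hsep s t hst])
  obtain ⟨b, hb0, hb⟩ : ∃ b : ℝ, 0 ≤ b ∧ ∀ i l, ‖B₀ i l‖ ≤ b :=
    ⟨‖B₀‖, norm_nonneg _, norm_entry_le_linfty_norm B₀⟩
  set P : ℝ := b + 1 + |R| with hP
  have hP1 : 1 ≤ P := by have := abs_nonneg R; linarith
  -- A common radius: `r * (r * P)` covers the diagonal of `T`, `r * P` the matrix norms, the
  -- eigenvalues and the data `a`, and `1` the indicator data of the spectral projections.
  set RR : ℝ := r * (r * P) + r * P + 1 with hRR
  have hrP : 0 ≤ (r : ℝ) * P := by positivity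
  have hrrP : 0 ≤ (r : ℝ) * (r * P) := by positivity
  obtain ⟨K₁, hK₁, hint⟩ := exists_lipschitz_aeval_interpolate (Matrix (Fin r) (Fin r) ℂ)
    (ι := Fin r) RR (γ / 2) (by positivity)
  obtain ⟨K₂, hK₂, hintC⟩ := exists_lipschitz_aeval_interpolate ℂ (ι := Fin r) RR (γ / 2)
    (by positivity)
  obtain ⟨K₃, hK₃, hchar⟩ := exists_lipschitz_aeval_prod (Matrix (Fin r) (Fin r) ℂ)
    (Finset.univ : Finset (Fin r)) RR
  set K₄ : ℝ := r * (r * (K₃ * r)) / (γ / 2) ^ (r - 1) with hK₄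
  have hK₄0 : 0 ≤ K₄ := by positivity
  refine ⟨min η 1, lt_min hη one_pos, K₁ + (r * (r * 1) + r * (r * (K₁ * r)) + K₂ * K₄),
    by positivity, fun V V' lam hV hB' => ?_⟩
  set B' := V * Matrix.diagonal lam * V' with hB'def
  have hentry : ∀ B : Matrix (Fin r) (Fin r) ℂ, (∀ i l, ‖B i l - B₀ i l‖ ≤ min η 1) →
      ∀ i l, ‖B i l‖ ≤ P := by
    intro B hB i l
    have h1 := (hB i l).trans (min_le_right _ _)
    have h2 := hb i l
    have h3 := norm_sub_norm_le (B i l) (B₀ i l)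
    have := abs_nonneg R
    linarith
  have hnorm : ∀ B : Matrix (Fin r) (Fin r) ℂ, (∀ i l, ‖B i l‖ ≤ P) → ‖B‖ ≤ RR := by
    intro B hB
    have := linfty_norm_le_of_entries B (by linarith) hB
    linarith
  have hB'n := hnorm B' (hentry B' hB')
  have hconjB' : ∀ p : ℂ[X], aeval B' p = V * Matrix.diagonal (fun s => p.eval (lam s)) * V' := by
    intro p
    rw [hB'def, aeval_conj V' V _ (mul_eq_one_comm.1 hV), aeval_diagonal]
  have hdetB' : ∀ x : ℂ, (x • 1 - B').det = ∏ s, (x - lam s) := by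
    intro x
    rw [hB'def, det_sub_conj V' V _ (mul_eq_one_comm.1 hV), det_sub_upper]
    · simp
    · intro a b hab
      exact Matrix.diagonal_apply_ne _ hab.ne'
  obtain ⟨τ', hτ'⟩ := hmatch B' (fun i l => (hB' i l).trans (min_le_left _ _)) lam hdetB'
  have hlamsep : ∀ s t, s ≠ t → γ / 2 ≤ ‖lam s - lam t‖ := by
    intro s t hst
    have h1 := hτ' (τ'.symm s)
    have h2 := hτ' (τ'.symm t)
    have h3 := hsep (τ'.symm s) (τ'.symm t) fun h => hst (τ'.symm.injective h)
    rw [Equiv.apply_symm_apply] at h1 h2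
    have h4 := norm_add₃_le (a := lam₀ (τ'.symm s) - lam s) (b := lam s - lam t)
      (c := -(lam₀ (τ'.symm t) - lam t))
    rw [norm_neg, show lam₀ (τ'.symm s) - lam s + (lam s - lam t) +
      -(lam₀ (τ'.symm t) - lam t) = lam₀ (τ'.symm s) - lam₀ (τ'.symm t) by ring] at h4
    linarith
  have hlam : ∀ t, ‖lam t‖ ≤ RR := by
    intro t
    have := norm_eigenvalue_le V V' hV lam (hentry B' hB') t
    linarith
  have hlaminj : Set.InjOn lam (Finset.univ : Finset (Fin r)) := by
    intro s _ t _ hst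
    by_contra hne
    have := hlamsep s t hne
    rw [hst, sub_self, norm_zero] at this
    linarith
  -- The key identity: every matrix with the same eigenvectors is a polynomial in `B'`, so it is
  -- controlled without bounding `V` or `V'`. Indicator data give the spectral projections.
  have hinterp : ∀ a : Fin r → ℂ, aeval B' (Lagrange.interpolate Finset.univ lam a) =
      V * Matrix.diagonal a * V' := by
    intro a
    rw [hconjB']
    congr 3
    funext s
    exact Lagrange.eval_interpolate_at_node _ hlaminj (Finset.mem_univ s)
  refine ⟨fun s i l => ?_, fun B Q hB hQ hT ε hε => ?_⟩
  · rw [← hinterp]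
    refine (norm_entry_le_linfty_norm _ i l).trans
      ((hint lam (Pi.single s 1) hlam (fun t => ?_) hlamsep B' B' hB'n hB'n).1.trans ?_)
    · have : ‖(Pi.single s 1 : Fin r → ℂ) t‖ ≤ 1 := by
        by_cases h : t = s
        · subst h; simp
        · simp [h]
      linarith
    · have : 0 ≤ r * (r * 1) + r * (r * (K₁ * r)) + K₂ * K₄ := by positivity
      linarith
  · set T := Q.conjTranspose * B * Q with hTdef
    have hBn := hnorm B (hentry B hB)
    have hQQ : Q.conjTranspose * Q = 1 := Matrix.mem_unitaryGroup_iff'.1 hQ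
    have hdetB : ∀ x : ℂ, (x • 1 - B).det = ∏ s, (x - T s s) := by
      intro x
      rw [← det_sub_conj Q Q.conjTranspose B hQQ, ← hTdef, det_sub_upper T hT]
    obtain ⟨τ, hτ⟩ := hmatch B (fun i l => (hB i l).trans (min_le_left _ _)) (fun s => T s s) hdetB
    -- Both spectra are matched to `lam₀`; the composite sends `T s s` to the nearby `lam`.
    refine ⟨τ.symm.trans τ', fun a M haR hM s => ?_⟩
    set t := (τ.symm.trans τ') s with ht
    have hε0 : 0 ≤ ε := (norm_nonneg _).trans (hε s s)
    have hBB' : ‖B - B'‖ ≤ r * ε := linfty_norm_le_of_entries _ hε0 hε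
    have hTs : ∀ p : ℂ[X], p.eval (T s s) = (Q.conjTranspose * aeval B p * Q) s s := by
      intro p
      rw [← (aeval_upper T hT p).2 s, hTdef, aeval_conj Q Q.conjTranspose B hQQ]
    have hTnorm : ‖T s s‖ ≤ RR := by
      have := norm_unitary_conj_entry_le Q B hQ (hentry B hB) s s
      rw [← hTdef] at this
      linarith
    have hfar : ∀ t', t' ≠ t → γ / 2 ≤ ‖T s s - lam t'‖ := by
      intro t' ht'
      have h1 := hτ (τ.symm s)
      have h2 := hτ' (τ'.symm t')
      rw [Equiv.apply_symm_apply] at h1 h2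
      have h3 := hsep (τ.symm s) (τ'.symm t') fun h => ht' (by
        rw [ht, Equiv.trans_apply, h, Equiv.apply_symm_apply])
      have h4 := norm_add₃_le (a := lam₀ (τ.symm s) - T s s) (b := T s s - lam t')
        (c := -(lam₀ (τ'.symm t') - lam t'))
      rw [norm_neg, show lam₀ (τ.symm s) - T s s + (T s s - lam t') +
        -(lam₀ (τ'.symm t') - lam t') = lam₀ (τ.symm s) - lam₀ (τ'.symm t') by ring] at h4
      linarith
    -- The characteristic polynomial `χ` of `B'` annihilates `B'`, so `aeval B χ` is O(ε), and so is
    -- its conjugated diagonal entry `χ.eval (T s s)`. All factors of that product except the one at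
    -- `t` are at least `γ / 2`.
    have hclose : ‖T s s - lam t‖ ≤ K₄ * ε := by
      set χ : ℂ[X] := ∏ t ∈ (Finset.univ : Finset (Fin r)), C ((fun _ => (1 : ℂ)) t) *
        (X - C (lam t)) with hχ
      have hRR1 : 1 ≤ RR := by linarith
      have h1 := (hchar (fun _ => 1) lam (fun _ => by simpa using hRR1) hlam B B' hBn hB'n).2
      rw [← hχ] at h1
      have hχeval : ∀ x, χ.eval x = ∏ t, (x - lam t) := by
        intro x
        simp [hχ, eval_prod]
      have hχ0 : aeval B' χ = 0 := by
        rw [hconjB']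
        have : (fun s => χ.eval (lam s)) = 0 := by
          funext u
          rw [hχeval]
          exact Finset.prod_eq_zero (Finset.mem_univ u) (sub_self _)
        rw [this]
        simp
      rw [hχ0, sub_zero] at h1
      have h2 : ‖χ.eval (T s s)‖ ≤ r * (r * (K₃ * r)) * ε := by
        rw [hTs]
        refine (norm_unitary_conj_entry_le Q _ hQ (fun i l =>
          (norm_entry_le_linfty_norm _ i l).trans
            (h1.trans (mul_le_mul_of_nonneg_left hBB' hK₃))) s s).trans_eq (by ring)
      rw [hχeval, ← Finset.mul_prod_erase _ _ (Finset.mem_univ t), norm_mul, norm_prod] at h2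
      have h3 : (γ / 2) ^ (r - 1) ≤ ∏ t' ∈ Finset.univ.erase t, ‖T s s - lam t'‖ := by
        have := Finset.prod_le_prod (s := Finset.univ.erase t) (f := fun _ : Fin r => γ / 2)
          (g := fun t' => ‖T s s - lam t'‖) (fun _ _ => by positivity)
          fun t' ht' => hfar t' (Finset.ne_of_mem_erase ht')
        rwa [Finset.prod_const, Finset.card_erase_of_mem (Finset.mem_univ t), Finset.card_univ,
          Fintype.card_fin] at this
      have h4 : 0 < (γ / 2) ^ (r - 1) := by positivity
      rw [hK₄, div_mul_eq_mul_div, le_div_iff₀ h4]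
      exact (mul_le_mul_of_nonneg_left h3 (norm_nonneg _)).trans h2
    have ha : ∀ t, ‖a t‖ ≤ RR := by
      intro u
      have h1 := norm_eigenvalue_le V V' hV a haR u
      have h2 : (r : ℝ) * R ≤ r * P := by
        gcongr
        have := le_abs_self R
        linarith
      linarith
    set p : ℂ[X] := Lagrange.interpolate Finset.univ lam a with hp
    set W := V * Matrix.diagonal a * V' with hW
    have hpt : p.eval (lam t) = a t :=
      Lagrange.eval_interpolate_at_node _ hlaminj (Finset.mem_univ t)
    have h1 : ‖(Q.conjTranspose * (M - W) * Q) s s‖ ≤ r * (r * ε) :=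
      norm_unitary_conj_entry_le Q _ hQ hM s s
    have h2 : ‖(Q.conjTranspose * (aeval B' p - aeval B p) * Q) s s‖ ≤ r * (r * (K₁ * (r * ε))) :=
      norm_unitary_conj_entry_le Q _ hQ (fun i l => (norm_entry_le_linfty_norm _ i l).trans (by
        rw [norm_sub_rev]
        exact (hint lam a hlam ha hlamsep B B' hBn hB'n).2.trans
          (mul_le_mul_of_nonneg_left hBB' hK₁))) s s
    have h3 : ‖p.eval (T s s) - p.eval (lam t)‖ ≤ K₂ * (K₄ * ε) := by
      have := (hintC lam a hlam ha hlamsep (T s s) (lam t) hTnorm (hlam t)).2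
      rw [coe_aeval_eq_eval, coe_aeval_eq_eval] at this
      exact this.trans (mul_le_mul_of_nonneg_left hclose hK₂)
    -- Three errors: from `M` to `W = aeval B' p`, from there to `aeval B p`, and from `T s s` to
    -- `lam t` inside `p`.
    have e : (Q.conjTranspose * M * Q) s s - a t = (Q.conjTranspose * (M - W) * Q) s s +
        (Q.conjTranspose * (aeval B' p - aeval B p) * Q) s s +
        (p.eval (T s s) - p.eval (lam t)) := by
      rw [hTs p, hpt, hinterp]
      simp only [Matrix.mul_sub, Matrix.sub_mul, Matrix.sub_apply]
      ring
    have hK₁ε : 0 ≤ K₁ * ε := by positivity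
    rw [e]
    refine (norm_add₃_le).trans ?_
    calc _ ≤ r * (r * ε) + r * (r * (K₁ * (r * ε))) + K₂ * (K₄ * ε) := by gcongr
      _ ≤ K₁ * ε + (r * (r * ε) + r * (r * (K₁ * (r * ε))) + K₂ * (K₄ * ε)) := by linarith
      _ = _ := by ring

end Spectral

theorem norm_apply_le_norm {ι : Type*} [Fintype ι] (x : EuclideanSpace ℂ ι) (i : ι) :
    ‖x i‖ ≤ ‖x‖ :=
  PiLp.norm_apply_le x i

theorem norm_le_card_mul {ι : Type*} [Fintype ι] (x : EuclideanSpace ℂ ι) {R : ℝ} (hR : 0 ≤ R)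
    (h : ∀ i, ‖x i‖ ≤ R) : ‖x‖ ≤ Fintype.card ι * R := by
  rw [EuclideanSpace.norm_eq]
  refine Real.sqrt_le_iff.2 ⟨by positivity, ?_⟩
  calc ∑ i, ‖x i‖ ^ 2 ≤ ∑ _i : ι, R ^ 2 :=
        Finset.sum_le_sum fun i _ => pow_le_pow_left₀ (norm_nonneg _) (h i) 2
    _ = Fintype.card ι * R ^ 2 := by simp
    _ ≤ (Fintype.card ι : ℝ) ^ 2 * R ^ 2 := by
        gcongr
        exact_mod_cast Nat.le_self_pow two_ne_zero _
    _ = (Fintype.card ι * R) ^ 2 := by ring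

/-! ### Exact generating matrices -/

section Format

variable {m r : ℕ} {n : Fin (m + 1) → ℕ}

/-- The matrix whose columns are the truncated first-mode vectors of `u`. -/
def firstMat (hr : r ≤ n 0 + 1) (u : Fin r → Vectors n) : Matrix (Fin r) (Fin r) ℂ :=
  Matrix.of fun i s => u s 0 (firstIdx hr i)

/-- The matrix with eigenvectors the truncated first-mode vectors of `u` and eigenvalues `a`. -/
def eigMat (hr : r ≤ n 0 + 1) (u : Fin r → Vectors n) (a : Fin r → ℂ) :
    Matrix (Fin r) (Fin r) ℂ :=
  firstMat hr u * Matrix.diagonal a * (firstMat hr u)⁻¹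

/-- The generating matrix of `sumOuter u`. -/
def exactGen (hr : r ≤ n 0 + 1) (u : Fin r → Vectors n) : Matrix (Fin r) (Fin r × Pair n) ℂ :=
  Matrix.of fun l τ => eigMat hr u (fun s => u s τ.2.1.succ τ.2.2.succ) τ.1 l

/-- The eigenvalues of the weighted sum of the matrices of `sumOuter u`. -/
def weightedValue (u : Fin r → Vectors n) (ξ : Pair n → ℝ) (s : Fin r) : ℂ :=
  ∑ q : Pair n, (ξ q : ℂ) * u s q.1.succ q.2.succ

/-- The nondegeneracy conditions on a tuple of rank-one terms. -/
structure Nondegenerate (hr : r ≤ n 0 + 1) (u : Fin r → Vectors n) (ξ : Pair n → ℝ) : Prop where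
  head : ∀ (s : Fin r) (j : Fin m), u s j.succ 0 = 1
  indep_first : LinearIndependent ℂ (fun (s : Fin r) (l : Fin r) => u s 0 (firstIdx hr l))
  indep_tail : LinearIndependent ℂ (fun s : Fin r => outer (tailVec (u s)))
  rank_matA : ∀ j : Fin m, (matA hr (sumOuter u) j).rank = r
  weighted_ne : ∀ s t : Fin r, s ≠ t → weightedValue u ξ s ≠ weightedValue u ξ t

theorem Nondegenerate.inv_mul {hr : r ≤ n 0 + 1} {u : Fin r → Vectors n} {ξ : Pair n → ℝ}
    (h : Nondegenerate hr u ξ) : (firstMat hr u)⁻¹ * firstMat hr u = 1 := by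
  have h1 : LinearIndependent ℂ (firstMat hr u).col := h.indep_first
  have h2 := Matrix.linearIndependent_cols_iff_isUnit.1 h1
  exact Matrix.nonsing_inv_mul _ ((Matrix.isUnit_iff_isUnit_det _).1 h2)

theorem sumOuter_apply (u : Fin r → Vectors n) (μ : (i : Fin (m + 1)) → Fin (n i + 1)) :
    sumOuter u μ = ∑ s, u s 0 (μ 0) * ∏ j : Fin m, u s j.succ (μ j.succ) := by
  simp only [sumOuter, outer, WithLp.ofLp_sum, Finset.sum_apply, Fin.prod_univ_succ]

theorem matM_exactGen (hr : r ≤ n 0 + 1) (u : Fin r → Vectors n) (q : Pair n) :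
    matM (exactGen hr u) q = eigMat hr u fun s => u s q.1.succ q.2.succ := rfl

theorem matMxi_exactGen (hr : r ≤ n 0 + 1) (u : Fin r → Vectors n) (ξ : Pair n → ℝ) :
    matMxi (exactGen hr u) ξ = eigMat hr u (weightedValue u ξ) := by
  have e : Matrix.diagonal (weightedValue u ξ) =
      ∑ q : Pair n, (ξ q : ℂ) • Matrix.diagonal fun s => u s q.1.succ q.2.succ := by
    ext i l
    rw [Matrix.sum_apply]
    by_cases h : i = l
    · subst h
      simp [weightedValue]
    · simp [Matrix.diagonal_apply_ne _ h]
  simp only [matMxi, matM_exactGen, eigMat, e, Matrix.mul_sum, Matrix.sum_mul, Matrix.mul_smul,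
    Matrix.smul_mul]

/-- The generating matrix of `sumOuter u` solves the defining linear systems exactly. -/
theorem matA_mulVec_exactGen (hr : r ≤ n 0 + 1) (u : Fin r → Vectors n)
    (hV : (firstMat hr u)⁻¹ * firstMat hr u = 1) (hu : ∀ (s : Fin r) (j : Fin m), u s j.succ 0 = 1)
    (i : Fin r) (q : Pair n) :
    Matrix.mulVec (matA hr (sumOuter u) q.1) (fun l => exactGen hr u l (i, q)) =
      vecB hr (sumOuter u) i q := by
  funext μ
  set D : Fin r → ℂ := fun s => u s q.1.succ q.2.succ with hD
  have hA : ∀ l, matA hr (sumOuter u) q.1 μ l =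
      ∑ s, firstMat hr u l s * ∏ j : Fin m, u s j.succ (μ.1 j.succ) := by
    intro l
    rw [matA, Matrix.of_apply, sumOuter_apply]
    simp [firstMat]
  have hB : vecB hr (sumOuter u) i q μ =
      ∑ s, (firstMat hr u i s * D s) * ∏ j : Fin m, u s j.succ (μ.1 j.succ) := by
    rw [vecB, sumOuter_apply]
    refine Finset.sum_congr rfl fun s _ => ?_
    rw [Function.update_of_ne (Fin.succ_ne_zero _).symm, Function.update_self, mul_assoc]
    congr 1
    -- The two products differ only in the mode of `q`: there the index of `μ` is zero and the
    -- normalization gives the factor one, while `vecB` gives `D s`.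
    rw [← Finset.mul_prod_erase _ _ (Finset.mem_univ q.1), Function.update_self,
      ← Finset.mul_prod_erase _ (fun j : Fin m => u s j.succ (μ.1 j.succ)) (Finset.mem_univ q.1),
      μ.2.2, hu, one_mul]
    congr 1
    refine Finset.prod_congr rfl fun j hj => ?_
    have hj' : j.succ ≠ q.1.succ := fun h => Finset.ne_of_mem_erase hj (Fin.succ_injective _ h)
    rw [Function.update_of_ne hj', Function.update_of_ne (Fin.succ_ne_zero _)]
  have hE : ∀ s, ∑ l, exactGen hr u l (i, q) * firstMat hr u l s = firstMat hr u i s * D s := by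
    intro s
    have : (eigMat hr u D * firstMat hr u) i s = firstMat hr u i s * D s := by
      rw [eigMat, Matrix.mul_assoc, hV, Matrix.mul_one, Matrix.mul_diagonal]
    rw [← this, Matrix.mul_apply]
    rfl
  rw [hB, Matrix.mulVec, dotProduct]
  simp only [hA, ← hE, Finset.sum_mul]
  rw [Finset.sum_comm]
  exact Finset.sum_congr rfl fun s _ => Finset.sum_congr rfl fun l _ => by ring

theorem mulVec_eq_zero_of_rank_eq {ι : Type*} [Fintype ι] (A : Matrix ι (Fin r) ℂ)
    (h : A.rank = r) (x : Fin r → ℂ) (hx : A.mulVec x = 0) : x = 0 := by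
  have h1 : LinearMap.ker A.mulVecLin = ⊥ := by
    rw [← Submodule.finrank_eq_zero (R := ℂ)]
    have h2 := LinearMap.finrank_range_add_finrank_ker A.mulVecLin
    rw [Module.finrank_fin_fun] at h2
    have h3 : Module.finrank ℂ (LinearMap.range A.mulVecLin) = r := h
    omega
  exact LinearMap.ker_eq_bot'.1 h1 x (by simpa using hx)

/-! ### Least squares stability of the generating matrix -/

/-- Stability of the least squares problem for the generating matrix. -/
theorem exists_generating_stability (hr : r ≤ n 0 + 1) (X₀ : Tensor n)
    (hrank : ∀ j : Fin m, (matA hr X₀ j).rank = r) :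
    ∃ η > 0, ∃ K : ℝ, 0 ≤ K ∧ ∀ u : Fin r → Vectors n,
      (firstMat hr u)⁻¹ * firstMat hr u = 1 → (∀ (s : Fin r) (j : Fin m), u s j.succ 0 = 1) →
      ‖sumOuter u - X₀‖ ≤ η →
      (∀ l τ, ‖exactGen hr u l τ‖ ≤ K) ∧
      ∀ F : Tensor n, ‖F - X₀‖ ≤ η → ∀ G : Matrix (Fin r) (Fin r × Pair n) ℂ,
        (∀ G', genObjective hr F G ≤ genObjective hr F G') →
        ∀ l τ, ‖G l τ - exactGen hr u l τ‖ ≤ K * ‖F - sumOuter u‖ := by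
  choose c₀ hc₀ η₀ hη₀ hlow using fun j : Fin m =>
    exists_lower_bound_mulVec (matA hr X₀ j) (mulVec_eq_zero_of_rank_eq _ (hrank j))
  obtain ⟨c, hc, hcle⟩ := exists_pos_forall_le c₀ hc₀
  obtain ⟨η, hη, hηle⟩ := exists_pos_forall_le η₀ hη₀
  set N : ℝ := ‖X₀‖ + 1 with hN
  have hN0 : 0 ≤ N := by positivity
  set K₁ : ℝ := r * (N / c) + 1 with hK₁
  have hK₁0 : 0 ≤ K₁ := by positivity
  set D : ℝ := ((Fintype.card ((j : Fin (m + 1)) → Fin (n j + 1)) : ℕ) : ℝ) with hD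
  set E : ℝ := ((Fintype.card (Fin r × Pair n) : ℕ) : ℝ) with hE
  have hD0 : 0 ≤ D := by positivity
  have hE0 : 0 ≤ E := by positivity
  have hlow' : ∀ F : Tensor n, ‖F - X₀‖ ≤ min η 1 → ∀ (j : Fin m) (x : Fin r → ℂ),
      c * ‖x‖ ≤ ‖(matA hr F j).mulVec x‖ := by
    intro F hF j x
    refine (mul_le_mul_of_nonneg_right (hcle j) (norm_nonneg x)).trans (hlow j _ (fun μ l => ?_) x)
    exact (norm_apply_le_norm (F - X₀) _).trans ((hF.trans (min_le_left _ _)).trans (hηle j))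
  refine ⟨min η 1, lt_min hη one_pos, N / c + (E * (D * K₁) + K₁) / c, by positivity,
    fun u hV hu hX => ?_⟩
  have hXN : ‖sumOuter u‖ ≤ N := by
    have h1 := norm_sub_norm_le (sumOuter u) X₀
    have h2 := hX.trans (min_le_right _ _)
    linarith
  -- The exact solution satisfies `c * ‖g‖ ≤ ‖A g‖ = ‖b‖ ≤ N`, a bound through the tensor alone.
  have hg : ∀ τ : Fin r × Pair n, ‖fun l => exactGen hr u l τ‖ ≤ N / c := by
    intro τ
    rw [le_div_iff₀' hc]
    refine (hlow' _ hX τ.2.1 _).trans ?_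
    rw [matA_mulVec_exactGen hr u hV hu τ.1 τ.2]
    exact (pi_norm_le_iff_of_nonneg hN0).2 fun μ => (norm_apply_le_norm _ _).trans hXN
  have hKc : 0 ≤ (E * (D * K₁) + K₁) / c := by positivity
  refine ⟨fun l τ => ((norm_le_pi_norm (fun l => exactGen hr u l τ) l).trans (hg τ)).trans
    (by linarith), fun F hF G hG l τ => ?_⟩
  set ε := ‖F - sumOuter u‖ with hε
  have hε0 : 0 ≤ ε := norm_nonneg _
  have hres : ∀ (τ : Fin r × Pair n) μ, ‖(Matrix.mulVec (matA hr F τ.2.1)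
      (fun l => exactGen hr u l τ) - vecB hr F τ.1 τ.2) μ‖ ≤ K₁ * ε := by
    intro τ μ
    have e : (Matrix.mulVec (matA hr F τ.2.1) (fun l => exactGen hr u l τ) -
        vecB hr F τ.1 τ.2) μ = ∑ l, (F - sumOuter u) (Function.update μ.1 0 (firstIdx hr l)) *
          exactGen hr u l τ - (F - sumOuter u) (Function.update
            (Function.update μ.1 0 (firstIdx hr τ.1)) τ.2.1.succ τ.2.2.succ) := by
      have h1 := congrFun (matA_mulVec_exactGen hr u hV hu τ.1 τ.2) μ
      simp only [Matrix.mulVec, dotProduct, matA, vecB, Matrix.of_apply, Pi.sub_apply,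
        PiLp.sub_apply, sub_mul, Finset.sum_sub_distrib] at h1 ⊢
      rw [h1]
      ring
    rw [e]
    refine (norm_sub_le _ _).trans ?_
    have h2 : ‖∑ l, (F - sumOuter u) (Function.update μ.1 0 (firstIdx hr l)) *
        exactGen hr u l τ‖ ≤ r * (ε * (N / c)) := by
      refine (norm_sum_le_of_le _ (n := fun _ => ε * (N / c)) fun l _ => ?_).trans_eq (by simp)
      rw [norm_mul]
      exact mul_le_mul (norm_apply_le_norm _ _)
        ((norm_le_pi_norm (fun l => exactGen hr u l τ) l).trans (hg τ)) (norm_nonneg _) hε0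
    have h3 := norm_apply_le_norm (F - sumOuter u) (Function.update
      (Function.update μ.1 0 (firstIdx hr τ.1)) τ.2.1.succ τ.2.2.succ)
    calc _ ≤ r * (ε * (N / c)) + ε := add_le_add h2 h3
      _ = K₁ * ε := by rw [hK₁]; ring
  have hobj : genObjective hr F (exactGen hr u) ≤ E * (D * (K₁ * ε)) ^ 2 := by
    refine (Finset.sum_le_card_nsmul _ _ ((D * (K₁ * ε)) ^ 2) fun τ _ => ?_).trans_eq
      (by rw [nsmul_eq_mul, Finset.card_univ])
    refine pow_le_pow_left₀ (norm_nonneg _) ?_ 2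
    refine (norm_le_card_mul _ (R := K₁ * ε) (by positivity) (hres τ)).trans ?_
    gcongr
    rw [hD]
    exact_mod_cast Fintype.card_subtype_le _
  -- The exact generating matrix is a competitor, so the minimizer has residual O(ε) in every
  -- column. Passing from squares to norms uses `E ≤ E ^ 2`.
  have hterm : ‖WithLp.toLp 2 (Matrix.mulVec (matA hr F τ.2.1) (fun l => G l τ) -
      vecB hr F τ.1 τ.2)‖ ≤ E * (D * (K₁ * ε)) := by
    have hE1 : 1 ≤ E := by
      rw [hE]
      exact_mod_cast Fintype.card_pos_iff.2 ⟨τ⟩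
    refine le_of_sq_le_sq ?_ (by positivity)
    refine (Finset.single_le_sum (f := fun τ : Fin r × Pair n =>
      ‖WithLp.toLp 2 (Matrix.mulVec (matA hr F τ.2.1) (fun l => G l τ) -
        vecB hr F τ.1 τ.2)‖ ^ 2) (fun _ _ => by positivity) (Finset.mem_univ τ)).trans ?_
    refine ((hG _).trans hobj).trans ?_
    rw [mul_pow E]
    exact mul_le_mul_of_nonneg_right (by nlinarith) (by positivity)
  -- Both columns have small residual for the same matrix and right-hand side; the lower bound on
  -- the matrix turns this into closeness.
  have hdiff : c * ‖(fun l => G l τ) - fun l => exactGen hr u l τ‖ ≤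
      E * (D * (K₁ * ε)) + K₁ * ε := by
    refine (hlow' F hF τ.2.1 _).trans ?_
    refine (pi_norm_le_iff_of_nonneg (by positivity)).2 fun μ => ?_
    have h1 := (norm_apply_le_norm _ μ).trans hterm
    have h2 := hres τ μ
    rw [Matrix.mulVec_sub]
    have h3 := norm_sub_le ((Matrix.mulVec (matA hr F τ.2.1) (fun l => G l τ) -
      vecB hr F τ.1 τ.2) μ) ((Matrix.mulVec (matA hr F τ.2.1) (fun l => exactGen hr u l τ) -
      vecB hr F τ.1 τ.2) μ)
    rw [← Pi.sub_apply, sub_sub_sub_cancel_right] at h3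
    exact h3.trans (add_le_add h1 h2)
  have h4 := norm_le_pi_norm ((fun l => G l τ) - fun l => exactGen hr u l τ) l
  have h5 : ‖(fun l => G l τ) - fun l => exactGen hr u l τ‖ ≤
      (E * (D * K₁) + K₁) / c * ε := by
    rw [div_mul_eq_mul_div, le_div_iff₀' hc]
    exact hdiff.trans_eq (by ring)
  calc ‖G l τ - exactGen hr u l τ‖ ≤ (E * (D * K₁) + K₁) / c * ε := h4.trans h5
    _ ≤ (N / c + (E * (D * K₁) + K₁) / c) * ε := by
        gcongr
        have : 0 ≤ N / c := by positivity
        linarith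

/-! ### Bounds for the first-mode vectors -/

/-- The flattening of a tensor restricted to the first `r` indices of the first mode. -/
def flatten (hr : r ≤ n 0 + 1) (F : Tensor n) :
    Matrix ((j : Fin (m + 1)) → Fin (n j + 1)) (Fin r) ℂ :=
  Matrix.of fun μ l => F (Function.update μ 0 (firstIdx hr l))

theorem flatten_sumOuter_mulVec (hr : r ≤ n 0 + 1) (u : Fin r → Vectors n) (x : Fin r → ℂ)
    (μ : (j : Fin (m + 1)) → Fin (n j + 1)) :
    (flatten hr (sumOuter u)).mulVec x μ =
      ∑ s, (∑ l, x l * firstMat hr u l s) * ∏ j : Fin m, u s j.succ (μ j.succ) := by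
  simp only [Matrix.mulVec, dotProduct, flatten, Matrix.of_apply, sumOuter_apply, Finset.sum_mul]
  rw [Finset.sum_comm]
  refine Finset.sum_congr rfl fun s _ => Finset.sum_congr rfl fun l _ => ?_
  simp only [Function.update_self, Function.update_of_ne (Fin.succ_ne_zero _), firstMat,
    Matrix.of_apply]
  ring

/-- A kernel vector gives a linear relation among the tail tensors with coefficients `Vᵀ x`; these
vanish by independence, and `V` is invertible. -/
theorem flatten_injective (hr : r ≤ n 0 + 1) (u : Fin r → Vectors n)
    (hV : (firstMat hr u)⁻¹ * firstMat hr u = 1)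
    (htail : LinearIndependent ℂ (fun s : Fin r => outer (tailVec (u s)))) (x : Fin r → ℂ)
    (hx : (flatten hr (sumOuter u)).mulVec x = 0) : x = 0 := by
  have h1 : ∀ s, ∑ l, x l * firstMat hr u l s = 0 := by
    refine Fintype.linearIndependent_iff.1 htail (fun s => ∑ l, x l * firstMat hr u l s) ?_
    ext ν
    have h2 := congrFun hx (Fin.cons (α := fun j => Fin (n j + 1)) 0 ν)
    rw [flatten_sumOuter_mulVec] at h2
    simpa [outer, tailVec] using h2
  have h3 : Matrix.vecMul x (firstMat hr u) = 0 := funext h1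
  have h4 := congrArg (fun y => Matrix.vecMul y (firstMat hr u)⁻¹) h3
  simp only [Matrix.vecMul_vecMul, mul_eq_one_comm.1 hV, Matrix.vecMul_one,
    Matrix.zero_vecMul] at h4
  exact h4

/-- The first-mode vectors are bounded in terms of the tensor and the spectral projections. -/
theorem exists_first_mode_bound (hr : r ≤ n 0 + 1) (X₀ : Tensor n)
    (hinj : ∀ x, (flatten hr X₀).mulVec x = 0 → x = 0) (P : ℝ) :
    ∃ η > 0, ∃ K : ℝ, 0 ≤ K ∧ ∀ u : Fin r → Vectors n,
      (firstMat hr u)⁻¹ * firstMat hr u = 1 → (∀ (s : Fin r) (j : Fin m), u s j.succ 0 = 1) →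
      ‖sumOuter u - X₀‖ ≤ η →
      (∀ s i l : Fin r, ‖eigMat hr u (Pi.single s 1) i l‖ ≤ P) →
      ∀ s i, ‖u s 0 i‖ ≤ K := by
  obtain ⟨c, hc, η, hη, hlow⟩ := exists_lower_bound_mulVec (flatten hr X₀) hinj
  set N : ℝ := ‖X₀‖ + 1 with hN
  have hN0 : 0 ≤ N := by positivity
  refine ⟨min η 1, lt_min hη one_pos, r * (N / c * (r * (|P| * N))), by positivity,
    fun u hV hu hX hP s i => ?_⟩
  have hXN : ‖sumOuter u‖ ≤ N := by
    have h1 := norm_sub_norm_le (sumOuter u) X₀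
    have h2 := hX.trans (min_le_right _ _)
    linarith
  -- Column `s` is the spectral projection for `s` applied to the sum of all columns, and that sum
  -- is a fibre of the tensor because the other modes are normalized.
  have hfirst : ∀ l, ‖firstMat hr u l s‖ ≤ r * (|P| * N) := by
    intro l
    have e : firstMat hr u l s = ∑ k, eigMat hr u (Pi.single s 1) l k *
        ∑ t, firstMat hr u k t := by
      have h1 : eigMat hr u (Pi.single s 1) * firstMat hr u =
          firstMat hr u * Matrix.diagonal (Pi.single s 1) := by
        rw [eigMat, Matrix.mul_assoc, hV, Matrix.mul_one]
      simp only [Finset.mul_sum]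
      rw [Finset.sum_comm]
      simp only [← Matrix.mul_apply, h1, Matrix.mul_diagonal]
      simp [Pi.single_apply]
    have hx : ∀ k, ‖∑ t, firstMat hr u k t‖ ≤ N := by
      intro k
      have e2 : ∑ t, firstMat hr u k t =
          sumOuter u (Function.update (fun _ => 0) 0 (firstIdx hr k)) := by
        rw [sumOuter_apply]
        simp [firstMat, hu]
      rw [e2]
      exact (norm_apply_le_norm _ _).trans hXN
    rw [e]
    refine (norm_sum_le_of_le _ (n := fun _ => |P| * N) fun k _ => ?_).trans_eq (by simp)
    rw [norm_mul]
    exact mul_le_mul ((hP s l k).trans (le_abs_self P)) (hx k) (norm_nonneg _) (abs_nonneg P)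
  -- `x` writes the `i`-th coordinates of the first-mode vectors as a combination of the first `r`
  -- ones. The flattening maps `x` to the slice with first index `i`, which bounds `x`.
  set x : Fin r → ℂ := Matrix.vecMul (fun t => u t 0 i) (firstMat hr u)⁻¹ with hxdef
  have hxV : ∀ t, ∑ l, x l * firstMat hr u l t = u t 0 i := by
    intro t
    have h1 : Matrix.vecMul x (firstMat hr u) = fun t => u t 0 i := by
      rw [hxdef, Matrix.vecMul_vecMul, hV, Matrix.vecMul_one]
    exact congrFun h1 t
  have hxN : ‖x‖ ≤ N / c := by
    rw [le_div_iff₀' hc]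
    refine (hlow (flatten hr (sumOuter u)) (fun μ l => ?_) x).trans ?_
    · exact (norm_apply_le_norm (sumOuter u - X₀) _).trans (hX.trans (min_le_left _ _))
    · refine (pi_norm_le_iff_of_nonneg hN0).2 fun μ => ?_
      rw [flatten_sumOuter_mulVec]
      simp only [hxV]
      have h1 := sumOuter_apply u (Function.update μ 0 i)
      simp only [Function.update_self, Function.update_of_ne (Fin.succ_ne_zero _)] at h1
      rw [← h1]
      exact (norm_apply_le_norm _ _).trans hXN
  rw [← hxV s]
  refine (norm_sum_le_of_le _ (n := fun _ => N / c * (r * (|P| * N))) fun l _ => ?_).trans_eq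
    (by simp)
  rw [norm_mul]
  exact mul_le_mul ((norm_le_pi_norm x l).trans hxN) (hfirst l) (norm_nonneg _) (by positivity)

end Format

/-! ### Uniform error bounds for the algorithm -/

section Format

variable {m r : ℕ} {n : Fin (m + 1) → ℕ}

theorem norm_matMxi_sub_le (G G' : Matrix (Fin r) (Fin r × Pair n) ℂ) (ξ : Pair n → ℝ) {η : ℝ}
    (h : ∀ l τ, ‖G l τ - G' l τ‖ ≤ η) (i l : Fin r) :
    ‖matMxi G ξ i l - matMxi G' ξ i l‖ ≤ (∑ q, |ξ q|) * η := by
  simp only [matMxi, Matrix.sum_apply, ← Finset.sum_sub_distrib, Finset.sum_mul]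
  refine norm_sum_le_of_le _ fun q _ => ?_
  rw [Matrix.smul_apply, Matrix.smul_apply, ← smul_sub, norm_smul, Complex.norm_real,
    Real.norm_eq_abs]
  exact mul_le_mul_of_nonneg_left (h l (i, q)) (abs_nonneg _)

/-- This makes `exactGen hr u` a minimizer for the input `sumOuter u`, so that stability of
minimizers also compares it with the one of a nearby tuple. -/
theorem genObjective_exactGen (hr : r ≤ n 0 + 1) (u : Fin r → Vectors n)
    (hV : (firstMat hr u)⁻¹ * firstMat hr u = 1)
    (hu : ∀ (s : Fin r) (j : Fin m), u s j.succ 0 = 1) :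
    genObjective hr (sumOuter u) (exactGen hr u) = 0 := by
  refine Finset.sum_eq_zero fun τ _ => ?_
  have h := matA_mulVec_exactGen hr u hV hu τ.1 τ.2
  rw [show (fun l => exactGen hr u l τ) = fun l => exactGen hr u l (τ.1, τ.2) from rfl, h]
  simp

theorem det_sub_eigMat (hr : r ≤ n 0 + 1) (u : Fin r → Vectors n)
    (hV : (firstMat hr u)⁻¹ * firstMat hr u = 1) (a : Fin r → ℂ) (x : ℂ) :
    (x • 1 - eigMat hr u a).det = ∏ s, (x - a s) := by
  rw [eigMat, det_sub_conj _ _ _ (mul_eq_one_comm.1 hV), det_sub_upper]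
  · simp
  · intro i l hil
    exact Matrix.diagonal_apply_ne _ hil.ne'

/-- Perturbing the vectors of all modes except the first one perturbs the tensor proportionally. -/
theorem norm_sumOuter_consVec_sub_le (y : Fin r → Fin (n 0 + 1) → ℂ)
    (v w : Fin r → Vectors fun j : Fin m => n j.succ) {Y R η : ℝ} (hY : 0 ≤ Y) (hR : 1 ≤ R)
    (hη : 0 ≤ η) (hy : ∀ s i, ‖y s i‖ ≤ Y) (hv : ∀ s j k, ‖v s j k‖ ≤ R)
    (hw : ∀ s j k, ‖w s j k‖ ≤ R) (hvw : ∀ s j k, ‖v s j k - w s j k‖ ≤ η) :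
    ‖sumOuter (fun s => consVec (y s) (v s)) - sumOuter fun s => consVec (n := n) (y s) (w s)‖ ≤
      Fintype.card ((j : Fin (m + 1)) → Fin (n j + 1)) * (r * (Y * (m * R ^ m * η))) := by
  refine norm_le_card_mul _ (by positivity) fun μ => ?_
  rw [PiLp.sub_apply, sumOuter_apply, sumOuter_apply, ← Finset.sum_sub_distrib]
  refine (norm_sum_le_of_le _ (n := fun _ => Y * (m * R ^ m * η)) fun s _ => ?_).trans_eq
    (by simp)
  simp only [consVec, Fin.cons_zero, Fin.cons_succ]
  rw [← mul_sub, norm_mul]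
  have h := norm_prod_sub_prod_le Finset.univ hR (fun j => v s j (μ j.succ))
    (fun j => w s j (μ j.succ)) (fun j => hv s j _) (fun j => hw s j _) (fun j => hvw s j _)
  rw [Finset.card_univ, Fintype.card_fin] at h
  exact mul_le_mul (hy s _) h (norm_nonneg _) hY

/-- The error bounds for all runs of the algorithm on `F`, relative to the tensor of `u`. -/
def ErrorBound (hr : r ≤ n 0 + 1) (F : Tensor n) (ξ : Pair n → ℝ) (u : Fin r → Vectors n)
    (K : ℝ) : Prop :=
  ∀ R : Run hr F ξ, ‖sumOuter u - R.Xgp‖ ≤ K * ‖F - sumOuter u‖ ∧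
    ‖F - R.Xgp‖ ≤ K * ‖F - sumOuter u‖

/-- The error bounds hold uniformly for all inputs and all nondegenerate tuples near a
nondegenerate tuple. -/
theorem Nondegenerate.exists_errorBound {hr : r ≤ n 0 + 1} {u₀ : Fin r → Vectors n}
    {ξ : Pair n → ℝ} (h₀ : Nondegenerate hr u₀ ξ) :
    ∃ δ > 0, ∃ K : ℝ, ∀ u : Fin r → Vectors n, Nondegenerate hr u ξ →
      ‖sumOuter u - sumOuter u₀‖ ≤ δ → ∀ F : Tensor n, ‖F - sumOuter u₀‖ ≤ δ →
        ErrorBound hr F ξ u K := by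
  obtain ⟨η₁, hη₁, K₁, hK₁, hgen⟩ := exists_generating_stability hr (sumOuter u₀) h₀.rank_matA
  have hinj : Function.Injective (weightedValue u₀ ξ) := fun s t hst => by
    by_contra hne
    exact h₀.weighted_ne s t hne hst
  obtain ⟨η₂, hη₂, K₂, hK₂, hspec⟩ := exists_schur_perturbation
    (eigMat hr u₀ (weightedValue u₀ ξ)) (weightedValue u₀ ξ) hinj
    (det_sub_eigMat hr u₀ h₀.inv_mul _) K₁
  obtain ⟨η₃, hη₃, K₃, hK₃, hfirst⟩ := exists_first_mode_bound hr (sumOuter u₀)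
    (flatten_injective hr u₀ h₀.inv_mul h₀.indep_tail) K₂
  set Ξ : ℝ := ∑ q, |ξ q| with hΞ
  have hΞ0 : 0 ≤ Ξ := Finset.sum_nonneg fun q _ => abs_nonneg _
  -- The second condition keeps the weighted sums within `η₂`, with the added ones avoiding zero
  -- divisors; the last one forces `ε ≤ 1`.
  obtain ⟨δ, hδ, hδ₁, hδ₂, hδ₃, hδ₄⟩ : ∃ δ > 0, δ ≤ η₁ ∧ (Ξ + 1) * (K₁ + 1) * δ ≤ η₂ ∧
      δ ≤ η₃ ∧ δ ≤ 1 / 2 := by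
    refine ⟨min η₁ (min (η₂ / ((Ξ + 1) * (K₁ + 1))) (min η₃ (1 / 2))), by positivity,
      min_le_left _ _, ?_, ?_, ?_⟩
    · rw [← le_div_iff₀' (by positivity)]
      exact (min_le_right _ _).trans (min_le_left _ _)
    · exact (min_le_right _ _).trans ((min_le_right _ _).trans (min_le_left _ _))
    · exact (min_le_right _ _).trans ((min_le_right _ _).trans (min_le_right _ _))
  set K₄ : ℝ := K₂ * ((Ξ + 1) * K₁) with hK₄
  set P : ℝ := r * K₁ + 1 + K₄ with hP
  have hK₄0 : 0 ≤ K₄ := by positivity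
  have hrK₁ : 0 ≤ r * K₁ := by positivity
  have hP1 : 1 ≤ P := by linarith
  set D : ℝ := ((Fintype.card ((j : Fin (m + 1)) → Fin (n j + 1)) : ℕ) : ℝ) with hD
  set K₅ : ℝ := D * (r * (K₃ * (m * P ^ m * K₄))) with hK₅
  refine ⟨δ, hδ, K₅ + 2, fun u hu hX F hF R => ?_⟩
  set ε : ℝ := ‖F - sumOuter u‖ with hε
  have hε0 : 0 ≤ ε := norm_nonneg _
  have hε1 : ε ≤ 1 := by
    have h1 := norm_sub_le (F - sumOuter u₀) (sumOuter u - sumOuter u₀)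
    rw [sub_sub_sub_cancel_right] at h1
    linarith
  obtain ⟨hexact, hG⟩ := hgen u hu.inv_mul hu.head (hX.trans hδ₁)
  have hexact₀ := (hgen u₀ h₀.inv_mul h₀.head (by simpa using hη₁.le)).2
  have hGε := hG F (hF.trans hδ₁) R.G R.G_opt
  have hnear : ∀ G : Matrix (Fin r) (Fin r × Pair n) ℂ,
      (∀ l τ, ‖G l τ - exactGen hr u₀ l τ‖ ≤ K₁ * δ) → ∀ i l,
        ‖matMxi G ξ i l - eigMat hr u₀ (weightedValue u₀ ξ) i l‖ ≤ η₂ := by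
    intro G hGδ i l
    rw [← matMxi_exactGen]
    refine ((norm_matMxi_sub_le G _ ξ hGδ i l).trans ?_).trans hδ₂
    rw [mul_assoc]
    gcongr <;> linarith
  have hBu : ∀ i l, ‖eigMat hr u (weightedValue u ξ) i l -
      eigMat hr u₀ (weightedValue u₀ ξ) i l‖ ≤ η₂ := by
    rw [← matMxi_exactGen hr u ξ]
    refine hnear _ fun l τ => ?_
    refine (hexact₀ (sumOuter u) (hX.trans hδ₁) (exactGen hr u) (fun G' => ?_) l τ).trans
      (mul_le_mul_of_nonneg_left hX hK₁)
    rw [genObjective_exactGen hr u hu.inv_mul hu.head]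
    exact Finset.sum_nonneg fun _ _ => by positivity
  have hBF : ∀ i l, ‖matMxi R.G ξ i l - eigMat hr u₀ (weightedValue u₀ ξ) i l‖ ≤ η₂ :=
    hnear _ fun l τ => (hexact₀ F (hF.trans hδ₁) R.G R.G_opt l τ).trans
      (mul_le_mul_of_nonneg_left hF hK₁)
  obtain ⟨hproj, hschur⟩ := hspec (firstMat hr u) (firstMat hr u)⁻¹ (weightedValue u ξ)
    hu.inv_mul hBu
  have hKε : K₁ * ε ≤ (Ξ + 1) * K₁ * ε := by
    have : 0 ≤ Ξ * (K₁ * ε) := by positivity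
    linarith
  -- The tolerance `(Ξ + 1) * K₁ * ε` covers both the weighted sum, with error `Ξ * K₁ * ε`, and
  -- each single matrix, with error `K₁ * ε`.
  obtain ⟨σ, hσ⟩ := hschur (matMxi R.G ξ) R.Q hBF R.Q_unitary
    (by rw [R.schur]; exact R.T_upper) ((Ξ + 1) * K₁ * ε) (fun i l => by
      have h1 := norm_matMxi_sub_le R.G _ ξ hGε i l
      rw [matMxi_exactGen] at h1
      refine h1.trans ?_
      have : 0 ≤ K₁ * ε := by positivity
      linarith)
  have hfirst' := hfirst u hu.inv_mul hu.head (hX.trans hδ₃) hproj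
  have hhat : ∀ (s : Fin r) (j : Fin m) (k : Fin (n j.succ + 1)),
      ‖hatV R.G R.Q s j k - tailVec (u (σ s)) j k‖ ≤ K₄ * ε := by
    intro s j k
    refine Fin.cases ?_ (fun k => ?_) k
    · simp only [hatV, Fin.cons_zero, tailVec, hu.head, sub_self, norm_zero]
      positivity
    · simp only [hatV, Fin.cons_succ, tailVec, dotProduct_star_mulVec]
      refine (hσ (fun s => u s j.succ k.succ) (matM R.G ⟨j, k⟩) (fun i l => hexact l (i, ⟨j, k⟩))
        (fun i l => (hGε l (i, ⟨j, k⟩)).trans hKε) s).trans_eq (by rw [hK₄]; ring)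
  have htail : ∀ (s : Fin r) (j : Fin m) (k : Fin (n j.succ + 1)),
      ‖tailVec (u s) j k‖ ≤ r * K₁ + 1 := by
    intro s j k
    refine Fin.cases ?_ (fun k => ?_) k
    · simp only [tailVec, hu.head, norm_one]
      linarith
    · have := norm_eigenvalue_le (firstMat hr u) (firstMat hr u)⁻¹ hu.inv_mul
        (fun s => u s j.succ k.succ) (fun i l => hexact l (i, ⟨j, k⟩)) s
      simp only [tailVec]
      linarith
  have hK₄ε : K₄ * ε ≤ K₄ := mul_le_of_le_one_right hK₄0 hε1
  have hsum := norm_sumOuter_consVec_sub_le (n := n) (fun s => u (σ s) 0) (hatV R.G R.Q)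
    (fun s => tailVec (u (σ s))) (η := K₄ * ε) hK₃ hP1 (by positivity)
    (fun s i => hfirst' (σ s) i) (fun s j k => by
      have h1 := norm_sub_norm_le (hatV R.G R.Q s j k) (tailVec (u (σ s)) j k)
      linarith [hhat s j k, htail (σ s) j k])
    (fun s j k => by linarith [htail (σ s) j k]) hhat
  have hperm : sumOuter (fun s => consVec (u (σ s) 0) (tailVec (u (σ s)))) = sumOuter u := by
    have h1 : ∀ w : Vectors n, consVec (w 0) (tailVec w) = w := fun w => Fin.cons_self_tail w
    simp only [h1, sumOuter]
    exact Equiv.sum_comp σ fun s => outer (u s)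
  rw [hperm] at hsum
  -- The true first-mode vectors, permuted by `σ`, compete in the least squares problem of the run.
  have hls : ‖R.Xgp - F‖ ≤ ‖sumOuter (fun s => consVec (u (σ s) 0) (hatV R.G R.Q s)) - F‖ :=
    le_of_sq_le_sq (R.z_opt fun s => u (σ s) 0) (norm_nonneg _)
  have hFX : ‖F - R.Xgp‖ ≤ K₅ * ε + ε := by
    rw [norm_sub_rev]
    refine hls.trans ?_
    have h1 := norm_sub_le_norm_sub_add_norm_sub
      (sumOuter fun s => consVec (u (σ s) 0) (hatV R.G R.Q s)) (sumOuter u) F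
    rw [norm_sub_rev (sumOuter u) F] at h1
    refine h1.trans (add_le_add (hsum.trans_eq ?_) le_rfl)
    rw [hK₅]
    ring
  have hXX := norm_sub_le_norm_sub_add_norm_sub (sumOuter u) F R.Xgp
  rw [norm_sub_rev (sumOuter u) F] at hXX
  constructor <;> linarith

theorem Run.norm_sub_Xopt_le {hr : r ≤ n 0 + 1} {F : Tensor n} {ξ : Pair n → ℝ}
    (R : Run hr F ξ) : ‖F - R.Xopt‖ ≤ ‖F - R.Xgp‖ := by
  rw [norm_sub_rev F, norm_sub_rev F]
  exact le_of_sq_le_sq R.w_improved (norm_nonneg _)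

/-! ### A constant depending only on the input and the weights -/

/-- The least natural number `k` that bounds the errors relative to all nondegenerate tuples whose
tensors are at distance less than `1 / (k + 1)` from `F`. -/
def errorConstant (hr : r ≤ n 0 + 1) (F : Tensor n) (ξ : Pair n → ℝ) : ℕ :=
  sInf {k : ℕ | ∀ u : Fin r → Vectors n, Nondegenerate hr u ξ →
    ‖F - sumOuter u‖ < 1 / (k + 1) → ErrorBound hr F ξ u k}

/-- The error constant is bounded near a nondegenerate tuple, and it is a valid constant there. -/
theorem Nondegenerate.exists_errorConstant_le {hr : r ≤ n 0 + 1} {u : Fin r → Vectors n}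
    {ξ : Pair n → ℝ} (h : Nondegenerate hr u ξ) :
    ∃ δ > 0, ∃ K : ℝ, ∀ F : Tensor n, ‖F - sumOuter u‖ < δ →
      (errorConstant hr F ξ : ℝ) ≤ K ∧ ErrorBound hr F ξ u (errorConstant hr F ξ) := by
  obtain ⟨δ, hδ, K, hK⟩ := h.exists_errorBound
  -- One `k` dominates the constant `K` and makes the radius `1 / (k + 1)` at most `δ / 2`, so any
  -- tuple that close to `F` has its tensor within `δ` of that of `u`.
  obtain ⟨k, hk⟩ := exists_nat_ge (max K (2 / δ))
  have hk1 : 1 / ((k : ℝ) + 1) ≤ δ / 2 := by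
    have h1 : 2 / δ ≤ k := (le_max_right _ _).trans hk
    rw [div_le_iff₀ hδ] at h1
    rw [div_le_iff₀ (by positivity)]
    linarith
  refine ⟨1 / ((k : ℝ) + 1), by positivity, k, fun F hF => ?_⟩
  have hmem : k ∈ {k : ℕ | ∀ u : Fin r → Vectors n, Nondegenerate hr u ξ →
      ‖F - sumOuter u‖ < 1 / (k + 1) → ErrorBound hr F ξ u k} := by
    intro u' hu' hFu' R
    have h1 := norm_sub_le (F - sumOuter u) (F - sumOuter u')
    rw [sub_sub_sub_cancel_left] at h1
    obtain ⟨h2, h3⟩ := hK u' hu' (by linarith) F (by linarith) R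
    have h4 : K * ‖F - sumOuter u'‖ ≤ k * ‖F - sumOuter u'‖ :=
      mul_le_mul_of_nonneg_right ((le_max_left _ _).trans hk) (norm_nonneg _)
    exact ⟨h2.trans h4, h3.trans h4⟩
  have hle : errorConstant hr F ξ ≤ k := Nat.sInf_le hmem
  have hle' : (errorConstant hr F ξ : ℝ) ≤ k := by exact_mod_cast hle
  -- The infimum is attained, and its radius is no smaller than that of `k`; hence `u` is among the
  -- tuples it covers.
  refine ⟨hle', Nat.sInf_mem ⟨k, hmem⟩ u h (hF.trans_le ?_)⟩
  exact one_div_le_one_div_of_le (by positivity) (add_le_add hle' le_rfl)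

end Format

end LowRank

end

theorem mainTheorem2 {m r : ℕ} (n : Fin (m + 1) → ℕ) (hr : r ≤ n 0 + 1) :
    ∃ C : LowRank.Tensor n → (LowRank.Pair n → ℝ) → ℝ,
      ∀ (u : Fin r → LowRank.Vectors n) (ξ : LowRank.Pair n → ℝ),
        (∀ q, 0 < ξ q) →
        (∀ (s : Fin r) (j : Fin m), u s j.succ 0 = 1) →
        LinearIndependent ℂ (fun (s : Fin r) (l : Fin r) => u s 0 (LowRank.firstIdx hr l)) →
        LinearIndependent ℂ (fun s : Fin r => LowRank.outer (LowRank.tailVec (u s))) →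
        (∀ j : Fin m, (LowRank.matA hr (LowRank.sumOuter u) j).rank = r) →
        (∀ s t : Fin r, s ≠ t →
          ∑ q : LowRank.Pair n, (ξ q : ℂ) * u s q.1.succ q.2.succ ≠
            ∑ q : LowRank.Pair n, (ξ q : ℂ) * u t q.1.succ q.2.succ) →
        ∃ δ > 0, ∃ K : ℝ, ∀ F : LowRank.Tensor n,
          ‖F - LowRank.sumOuter u‖ < δ →
          LowRank.ScalingOptimal F u →
          C F ξ ≤ K ∧
          ∀ R : LowRank.Run hr F ξ,
            ‖LowRank.sumOuter u - R.Xgp‖ ≤ C F ξ * ‖F - LowRank.sumOuter u‖ ∧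
            ‖F - R.Xopt‖ ≤ ‖F - R.Xgp‖ ∧
            ‖F - R.Xgp‖ ≤ C F ξ * ‖F - LowRank.sumOuter u‖ := by
  refine ⟨fun F ξ => LowRank.errorConstant hr F ξ, fun u ξ _ h1 h2 h3 h4 h5 => ?_⟩
  obtain ⟨δ, hδ, K, hK⟩ :=
    (LowRank.Nondegenerate.mk h1 h2 h3 h4 h5 : LowRank.Nondegenerate hr u ξ).exists_errorConstant_le
  refine ⟨δ, hδ, K, fun F hF _ => ?_⟩
  obtain ⟨hle, hbound⟩ := hK F hF
  exact ⟨hle, fun R => ⟨(hbound R).1, R.norm_sub_Xopt_le, (hbound R).2⟩⟩
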